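/- **Setting.** Let $\mathcal A$ be a category with a site $\mathcal T$: a collection of covering families $(U_i\to X)_i$ that contains the isomorphisms, whose members have pullbacks along all arrows, and that is closed under base change and composition. Assume that $\mathcal T$ is subcanonical, that being a cover is a local property, and that $\mathcal T$ admits effective descent (for each cover $(U_i\to X)_i$ the descent functor from $\mathcal A/X$ to descent data is an equivalence of categories). An *admissible epimorphism* is an arrow $f$ whose pullbacks along all arrows exist and are epimorphisms with local lifts (some cover of the codomain factors through them). Assume that every admissible epimorphism onto a terminal object $\bullet$ has a section. An *internal groupoid* $\mathcal G=(\mathcal G_1\rightrightarrows\mathcal G_0)$ is a groupoid in $\mathcal A$ whose range map is an admissible epimorphism; its *strict arrows* are the internal functors. All internal groupoids are assumed to be global objects of virtual manifolds; a virtual manifold $\widehat{\mathcal M}$ enters through its global groupoid $\mathcal G=\widehat{\mathcal M}(X)$ over $X=\mathcal G_0$, and $\widehat{\mathcal M}(U)$ is the full subgroupoid over $U\rightarrowtail X$. **Homotopy.** Let $\mathcal G^{\mathcal I}$ be the groupoid of arrows of $\mathcal G$ (the cotensor with the groupoid $\mathcal I$ on two objects with exactly one arrow between any two objects), with end-point projections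 $e_0,e_1\colon\mathcal G^{\mathcal I}\to\mathcal G$. A *homotopy* from $\varphi$ to $\psi\colon\mathcal H\to\mathcal G$ is a strict arrow $H\colon\mathcal H\to\mathcal G^{\mathcal I}$ with $e_0H=\varphi$, $e_1H=\psi$; $\varphi,\psi$ are *strongly homotopic* if they are joined by a finite chain of homotopies, and *strong homotopy equivalences* are defined accordingly. A strict arrow $\epsilon\colon\mathcal H\to\mathcal G$ is an *essential equivalence* if $\mathcal G_1\times_{\mathcal G_0}\mathcal H_0\to\mathcal G_0$, $(\gamma,x)\mapsto r(\gamma)$ (with $s(\gamma)=\epsilon(x)$), is an admissible epimorphism and $\mathcal H_1$ is the pullback of $(s,r)\colon\mathcal G_1\to\mathcal G_0\times\mathcal G_0$ along $\epsilon\times\epsilon$. A strict arrow is an *essential homotopy equivalence*, i.e. lies in $W$, if it is strongly homotopic to $\epsilon\circ h$ with $h$ a strong homotopy equivalence and $\epsilon$ an essential equivalence. **Localization.** The $1$-arrows $\mathcal K\to\mathcal G$ of the bicategory localized at $W$ are the spans $\mathcal K\xleftarrow{\eta}\mathcal J\xrightarrow{\varphi}\mathcal G$ with $\eta\in W$, composed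 by (iterated) homotopy pullbacks. Spans $(\eta,\varphi)$ and $(\eta',\varphi')$ are *Morita homotopic* if there are $u,v\in W$ from a common groupoid to their apexes such that $\eta u,\eta'v$ and $\varphi u,\varphi'v$ are strongly homotopic. Write $\widehat{\mathcal M}\sim_W\widehat{\mathcal N}$ if the global groupoids are equivalent in the localized bicategory, i.e. there are $1$-arrows in both directions whose composites are Morita homotopic to the identities. **Geometric complexity.** A *point groupoid* is an internal groupoid whose object of objects is terminal. A *constant bimap* is a span $\mathcal H\xleftarrow{\epsilon}\mathcal B\xrightarrow{c}\mathcal G$ with $\epsilon$ an essential equivalence and $c$ factoring through a strict arrow from a point groupoid to $\mathcal G$. A full subgroupoid $\widehat{\mathcal M}(U)$ over a subobject $U\rightarrowtail X$ invariant under $\mathcal G$ is a *weak point subgroupoid* if the inclusion $\widehat{\mathcal M}(U)\hookrightarrow\widehat{\mathcal M}(X)$, viewed as the span with left leg the identity, is Morita homotopic to a constant bimap. The *geometric complexity* $c^{\mathrm{geo}}(\widehat{\mathcal M})\in\mathbb N\cup\{\infty\}$ is the least $n$ for which there are weak point subgroupoids $\widehat{\mathcal M}(U_1),\dots,\widehat{\mathcal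 M}(U_n)$ such that $(U_k\rightarrowtail X)_{k=1}^n$ is a cover in $\mathcal T$, and $\infty$ if there is no such $n$. **Proposition.** If $\widehat{\mathcal M}\sim_W\widehat{\mathcal N}$, then $c^{\mathrm{geo}}(\widehat{\mathcal M})=c^{\mathrm{geo}}(\widehat{\mathcal N})$. -/

import Mathlib

open CategoryTheory Limits

universe v u

namespace AbsoluteGeometry

variable {A : Type u} [Category.{v} A]

/-! ## The ambient site

A site on `A` is a `Precoverage T` that contains the isomorphisms, has pullbacks of covers, and is
stable under base change and under composition (the Mathlib classes `HasIsos`, `HasPullbacks`,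
`IsStableUnderBaseChange`, `IsStableUnderComposition`). -/

section Site

variable (T : Precoverage A)

/-- All representable presheaves satisfy the sheaf condition for the covers of `T`. -/
def IsSubcanonical : Prop :=
  ∀ ⦃X : A⦄ (R : Presieve X), R ∈ T X → ∀ W : A, Presieve.IsSheafFor (yoneda.obj W) R

/-- Being a cover is a local property: if `(U i ⟶ X)` is a cover and a family `(Y j ⟶ X)` has
pullbacks along every `U i ⟶ X` which form a cover of `U i`, then `(Y j ⟶ X)` is a cover. -/
def CoversAreLocal : Prop :=
  ∀ ⦃X : A⦄ {ι κ : Type (max u v)} (U : ι → A) (f : ∀ i, U i ⟶ X) (Y : κ → A)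
    (g : ∀ j, Y j ⟶ X) (P : ι → κ → A) (p : ∀ i j, P i j ⟶ U i) (q : ∀ i j, P i j ⟶ Y j),
    Presieve.ofArrows U f ∈ T X →
    (∀ i j, IsPullback (p i j) (q i j) (f i) (g j)) →
    (∀ i, Presieve.ofArrows (P i) (p i) ∈ T (U i)) →
    Presieve.ofArrows Y g ∈ T X

/-- `f : S ⟶ X` lifts locally: some cover of `X` factors through `f`. -/
def LocallyLiftable {S X : A} (f : S ⟶ X) : Prop :=
  ∃ R ∈ T X, ∀ ⦃U : A⦄ (g : U ⟶ X), R g → ∃ l : U ⟶ S, l ≫ f = g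

/-- The admissible epimorphisms: `f` has a pullback along every arrow, and each
pullback of `f` (in particular `f` itself) is an epimorphism that lifts locally.
This is the largest class of epimorphisms with local lifts that is stable under pullback. -/
def AdmissibleEpi : MorphismProperty A := fun S X f =>
  (∀ ⦃Y : A⦄ (g : Y ⟶ X), HasPullback f g) ∧
    ∀ ⦃P Y : A⦄ (p : P ⟶ S) (q : P ⟶ Y) (g : Y ⟶ X), IsPullback p q f g →
      Epi q ∧ LocallyLiftable T q

lemma AdmissibleEpi.of_isIso [T.HasIsos] {S X : A} (f : S ⟶ X) [IsIso f] : AdmissibleEpi T f := by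
  refine ⟨fun Y g => hasPullback_of_left_iso f g, fun P Y p q g h => ?_⟩
  have : IsIso q := h.isIso_snd_of_isIso
  exact ⟨inferInstance, _, T.mem_coverings_of_isIso (𝟙 Y), fun _ g _ => ⟨g ≫ inv q, by simp⟩⟩

variable {T}

lemma AdmissibleEpi.of_isPullback {P S Y X : A} {p : P ⟶ S} {q : P ⟶ Y} {f : S ⟶ X} {g : Y ⟶ X}
    (hf : AdmissibleEpi T f) (h : IsPullback p q f g) : AdmissibleEpi T q := by
  refine ⟨fun Z k => ?_, fun P' Z p' q' k h' => hf.2 (p' ≫ p) q' (k ≫ g) (h'.paste_horiz h)⟩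
  have := hf.1 (k ≫ g)
  exact (IsPullback.of_right' (IsPullback.of_hasPullback f (k ≫ g)) h).hasPullback

lemma AdmissibleEpi.comp [T.IsStableUnderComposition] {S Y X : A} {f : S ⟶ Y} {g : Y ⟶ X}
    (hf : AdmissibleEpi T f) (hg : AdmissibleEpi T g) : AdmissibleEpi T (f ≫ g) := by
  refine ⟨fun Z k => ?_, fun P Z p q k h => ?_⟩
  · have := hg.1 k
    have := hf.1 (pullback.fst g k)
    exact ((IsPullback.of_hasPullback f (pullback.fst g k)).flip.paste_horiz
      (IsPullback.of_hasPullback g k).flip).flip.hasPullback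
  · have := hg.1 k
    have hg' := IsPullback.of_hasPullback g k
    have h' := (IsPullback.of_right' h.flip hg'.flip).flip
    obtain ⟨h₁, R, hR, hl⟩ := hg.2 _ _ _ hg'
    have hq : q = hg'.flip.lift q (p ≫ f) (by rw [Category.assoc, h.w]) ≫ pullback.snd g k := by
      simp
    have hf' := hf.of_isPullback h'
    have := (hf'.2 _ _ (𝟙 _) (IsPullback.id_horiz _)).1
    rw [hq]
    refine ⟨epi_comp _ _, ?_⟩
    obtain ⟨ι, U, u, rfl⟩ := R.exists_eq_ofArrows
    choose l hl using fun i => hl (u i) (Presieve.ofArrows.mk i)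
    have hh : ∀ i, ∃ (κ : Type _) (V : κ → A) (w : ∀ j, V j ⟶ U i),
        Presieve.ofArrows V w ∈ T (U i) ∧ ∀ j, ∃ m : V j ⟶ P,
          m ≫ hg'.flip.lift q (p ≫ f) (by rw [Category.assoc, h.w]) = w j ≫ l i := by
      intro i
      have := hf'.1 (l i)
      obtain ⟨-, R', hR', hm⟩ := hf'.2 _ _ _ (IsPullback.of_hasPullback _ (l i))
      obtain ⟨κ, V, w, rfl⟩ := R'.exists_eq_ofArrows
      refine ⟨κ, V, w, hR', fun j => ?_⟩
      obtain ⟨m, hm⟩ := hm (w j) (Presieve.ofArrows.mk j)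
      exact ⟨m ≫ pullback.fst _ _, by rw [Category.assoc, pullback.condition, reassoc_of% hm]⟩
    choose κ V w hw m hm using hh
    refine ⟨_, T.comp_mem_coverings u hR w hw, ?_⟩
    rintro _ _ ⟨⟨i, j⟩⟩
    exact ⟨m i j, by rw [reassoc_of% (hm i j), hl]⟩

/-- Points lift: every admissible epimorphism onto a terminal object has a section. -/
def PointsLift (T : Precoverage A) : Prop :=
  ∀ ⦃Z pt : A⦄ (f : Z ⟶ pt), Nonempty (IsTerminal pt) → AdmissibleEpi T f →
    ∃ x : pt ⟶ Z, x ≫ f = 𝟙 pt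

end Site

/-! ## Descent -/

section Descent

variable {X : A} {ι : Type (max u v)} {U : ι → A} (φ : ∀ i, U i ⟶ X)

/-- A descent datum for a family `φ i : U i ⟶ X`: objects `a i : obj i ⟶ U i` together with
transition arrows over the overlaps `U i ×_X U j`. An arrow into the pullback of `obj i` to
`U i ×_X U j` is a pair `x : S ⟶ obj i`, `t : S ⟶ U j` that agrees in `X`; `trans` is the induced
natural map to arrows into the pullback of `obj j`, subject to the unit and cocycle conditions. -/
structure DescentDatum where
  obj : ι → A
  hom : ∀ i, obj i ⟶ U i
  trans : ∀ (i j : ι) {S : A} (x : S ⟶ obj i) (t : S ⟶ U j),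
    x ≫ hom i ≫ φ i = t ≫ φ j → (S ⟶ obj j)
  trans_hom : ∀ (i j : ι) {S : A} (x : S ⟶ obj i) (t : S ⟶ U j)
    (h : x ≫ hom i ≫ φ i = t ≫ φ j), trans i j x t h ≫ hom j = t
  comp_trans : ∀ (i j : ι) {S S' : A} (k : S' ⟶ S) (x : S ⟶ obj i) (t : S ⟶ U j)
    (h : x ≫ hom i ≫ φ i = t ≫ φ j),
    k ≫ trans i j x t h = trans i j (k ≫ x) (k ≫ t) (by simp only [Category.assoc, h])
  trans_self : ∀ (i : ι) {S : A} (x : S ⟶ obj i),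
    trans i i x (x ≫ hom i) (Category.assoc _ _ _).symm = x
  trans_trans : ∀ (i j k : ι) {S : A} (x : S ⟶ obj i) (t : S ⟶ U j) (t' : S ⟶ U k)
    (h : x ≫ hom i ≫ φ i = t ≫ φ j) (h' : t ≫ φ j = t' ≫ φ k),
    trans j k (trans i j x t h) t' (by rw [← Category.assoc, trans_hom, h']) =
      trans i k x t' (h.trans h')

namespace DescentDatum

variable {φ}

/-- Arrows of descent data: arrows over each `U i` that commute with the transitions. -/
@[ext]
structure Hom (D E : DescentDatum φ) where
  app : ∀ i, D.obj i ⟶ E.obj i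
  app_hom : ∀ i, app i ≫ E.hom i = D.hom i
  trans_app : ∀ (i j : ι) {S : A} (x : S ⟶ D.obj i) (t : S ⟶ U j)
    (h : x ≫ D.hom i ≫ φ i = t ≫ φ j),
    D.trans i j x t h ≫ app j =
      E.trans i j (x ≫ app i) t (by rw [Category.assoc, reassoc_of% (app_hom i), h])

instance : Category (DescentDatum φ) where
  Hom := Hom
  id D :=
    { app := fun i => 𝟙 (D.obj i)
      app_hom := fun i => Category.id_comp _
      trans_app := by intros; simp }
  comp f g :=
    { app := fun i => f.app i ≫ g.app i
      app_hom := fun i => by rw [Category.assoc, g.app_hom, f.app_hom]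
      trans_app := by
        intro i j S x t h
        rw [← Category.assoc, f.trans_app, g.trans_app]
        simp only [Category.assoc] }
  id_comp f := Hom.ext (funext fun i => Category.id_comp _)
  comp_id f := Hom.ext (funext fun i => Category.comp_id _)
  assoc f g h := Hom.ext (funext fun i => Category.assoc _ _ _)

end DescentDatum

variable [∀ (B : Over X) (i : ι), HasPullback B.hom (φ i)]

/-- The descent functor: it sends `B` over `X` to its pullbacks along the `φ i`. -/
noncomputable def descentFunctor : Over X ⥤ DescentDatum φ where
  obj B :=
    { obj := fun i => pullback B.hom (φ i)
      hom := fun i => pullback.snd B.hom (φ i)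
      trans := fun i j S x t h => pullback.lift (x ≫ pullback.fst B.hom (φ i)) t (by
        rw [Category.assoc, pullback.condition, h])
      trans_hom := fun i j S x t h => pullback.lift_snd _ _ _
      comp_trans := fun i j S S' k x t h => by
        apply pullback.hom_ext <;> simp [pullback.lift_fst, pullback.lift_snd]
      trans_self := fun i S x => by
        apply pullback.hom_ext <;> simp [pullback.lift_fst, pullback.lift_snd]
      trans_trans := fun i j k S x t t' h h' => by
        apply pullback.hom_ext <;> simp [pullback.lift_fst, pullback.lift_snd] }
  map {B C} f :=
    { app := fun i => pullback.lift (pullback.fst B.hom (φ i) ≫ f.left)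
        (pullback.snd B.hom (φ i)) (by rw [Category.assoc, Over.w f, pullback.condition])
      app_hom := fun i => pullback.lift_snd _ _ _
      trans_app := fun i j S x t h => by
        dsimp only at x h ⊢
        apply pullback.hom_ext <;> simp [pullback.lift_fst, pullback.lift_snd, pullback.lift_fst_assoc] }
  map_id B := DescentDatum.Hom.ext (funext fun i => by
    apply pullback.hom_ext
    · exact (pullback.lift_fst _ _ _).trans
        ((Category.comp_id _).trans (Category.id_comp _).symm)
    · exact (pullback.lift_snd _ _ _).trans (Category.id_comp _).symm)
  map_comp {B C D} f g := DescentDatum.Hom.ext (funext fun i => by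
    change _ = pullback.lift _ _ _ ≫ pullback.lift _ _ _
    dsimp only
    apply pullback.hom_ext <;> simp [pullback.lift_fst, pullback.lift_snd, pullback.lift_fst_assoc])

/-- The site admits effective descent: every descent functor is an equivalence. -/
def EffectiveDescent (T : Precoverage A) [T.HasPullbacks] : Prop :=
  ∀ ⦃X : A⦄ {ι : Type (max u v)} (U : ι → A) (φ : ∀ i, U i ⟶ X)
    (hφ : Presieve.ofArrows U φ ∈ T X),
    haveI : ∀ (B : Over X) (i : ι), HasPullback B.hom (φ i) := fun B i =>
      haveI := (T.hasPullbacks_of_mem B.hom hφ).hasPullback (Presieve.ofArrows.mk i)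
      hasPullback_symmetry (φ i) B.hom
    (descentFunctor φ).IsEquivalence

end Descent

/-! ## Internal groupoids and strict arrows -/

variable {T : Precoverage A}

/-- The data of an internal groupoid: `s`, `r`, `u`, `i` and `m`, where `m` is defined on the
pullback `G₁ * G₁ = {(γ, η) : s γ = r η}`. -/
structure GroupoidData (A : Type u) [Category.{v} A] where
  obj : A
  arr : A
  src : arr ⟶ obj
  tgt : arr ⟶ obj
  unit : obj ⟶ arr
  inv : arr ⟶ arr
  pairs : A
  fst : pairs ⟶ arr
  snd : pairs ⟶ arr
  isPullback : IsPullback fst snd src tgt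
  m : pairs ⟶ arr

/-- The product `γ · η` of two composable generalized elements. -/
noncomputable def GroupoidData.mul (G : GroupoidData A) {S : A} (γ η : S ⟶ G.arr)
    (h : γ ≫ G.src = η ≫ G.tgt) : S ⟶ G.arr :=
  G.isPullback.lift γ η h ≫ G.m

/-- The groupoid axioms. -/
structure GroupoidData.IsGroupoid (G : GroupoidData A) : Prop where
  unit_src : G.unit ≫ G.src = 𝟙 G.obj
  unit_tgt : G.unit ≫ G.tgt = 𝟙 G.obj
  inv_src : G.inv ≫ G.src = G.tgt
  inv_tgt : G.inv ≫ G.tgt = G.src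
  m_src : G.m ≫ G.src = G.snd ≫ G.src
  m_tgt : G.m ≫ G.tgt = G.fst ≫ G.tgt
  unit_mul : G.mul (G.tgt ≫ G.unit) (𝟙 G.arr) (by simp [unit_src]) = 𝟙 G.arr
  mul_unit : G.mul (𝟙 G.arr) (G.src ≫ G.unit) (by simp [unit_tgt]) = 𝟙 G.arr
  inv_mul : G.mul G.inv (𝟙 G.arr) (by simp [inv_src]) = G.src ≫ G.unit
  mul_inv : G.mul (𝟙 G.arr) G.inv (by simp [inv_tgt]) = G.tgt ≫ G.unit
  mul_assoc : ∀ {S : A} (γ η ζ : S ⟶ G.arr) (h : γ ≫ G.src = η ≫ G.tgt)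
    (h' : η ≫ G.src = ζ ≫ G.tgt),
    G.mul (G.mul γ η h) ζ (by simp [GroupoidData.mul, m_src, h']) =
      G.mul γ (G.mul η ζ h') (by simp [GroupoidData.mul, m_tgt, h])

variable (T) in
/-- A groupoid internal to the site structure: a groupoid in `A` whose range map `r` is an
admissible epimorphism. -/
structure InternalGroupoid extends GroupoidData A where
  isGroupoid : toGroupoidData.IsGroupoid
  tgt_admissible : AdmissibleEpi T tgt

namespace InternalGroupoid

section Elements

variable (G : InternalGroupoid T) {S : A}

@[simp] lemma mul_src (γ η : S ⟶ G.arr) (h : γ ≫ G.src = η ≫ G.tgt) :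
    G.mul γ η h ≫ G.src = η ≫ G.src := by
  simp [GroupoidData.mul, G.isGroupoid.m_src]

@[simp] lemma mul_tgt (γ η : S ⟶ G.arr) (h : γ ≫ G.src = η ≫ G.tgt) :
    G.mul γ η h ≫ G.tgt = γ ≫ G.tgt := by
  simp [GroupoidData.mul, G.isGroupoid.m_tgt]

lemma comp_mul {S' : A} (k : S' ⟶ S) (γ η : S ⟶ G.arr) (h : γ ≫ G.src = η ≫ G.tgt) :
    k ≫ G.mul γ η h = G.mul (k ≫ γ) (k ≫ η) (by simp only [Category.assoc, h]) := by
  rw [GroupoidData.mul, GroupoidData.mul, ← Category.assoc]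
  congr 1
  apply G.isPullback.hom_ext <;> simp

lemma unit_mul (x : S ⟶ G.obj) (γ : S ⟶ G.arr) (h : (x ≫ G.unit) ≫ G.src = γ ≫ G.tgt) :
    G.mul (x ≫ G.unit) γ h = γ := by
  have hx : x = γ ≫ G.tgt := by simpa [G.isGroupoid.unit_src] using h
  subst hx
  simpa [comp_mul] using congr(γ ≫ $(G.isGroupoid.unit_mul))

lemma mul_unit (x : S ⟶ G.obj) (γ : S ⟶ G.arr) (h : γ ≫ G.src = (x ≫ G.unit) ≫ G.tgt) :
    G.mul γ (x ≫ G.unit) h = γ := by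
  have hx : x = γ ≫ G.src := by simpa [G.isGroupoid.unit_tgt] using h.symm
  subst hx
  simpa [comp_mul] using congr(γ ≫ $(G.isGroupoid.mul_unit))

lemma inv_mul (γ : S ⟶ G.arr) (h : (γ ≫ G.inv) ≫ G.src = γ ≫ G.tgt) :
    G.mul (γ ≫ G.inv) γ h = (γ ≫ G.src) ≫ G.unit := by
  simpa [comp_mul] using congr(γ ≫ $(G.isGroupoid.inv_mul))

lemma mul_inv (γ : S ⟶ G.arr) (h : γ ≫ G.src = (γ ≫ G.inv) ≫ G.tgt) :
    G.mul γ (γ ≫ G.inv) h = (γ ≫ G.tgt) ≫ G.unit := by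
  simpa [comp_mul] using congr(γ ≫ $(G.isGroupoid.mul_inv))

@[simp] lemma comp_inv_src (γ : S ⟶ G.arr) : (γ ≫ G.inv) ≫ G.src = γ ≫ G.tgt := by
  rw [Category.assoc, G.isGroupoid.inv_src]

@[simp] lemma comp_inv_tgt (γ : S ⟶ G.arr) : (γ ≫ G.inv) ≫ G.tgt = γ ≫ G.src := by
  rw [Category.assoc, G.isGroupoid.inv_tgt]

@[simp] lemma comp_unit_src (x : S ⟶ G.obj) : (x ≫ G.unit) ≫ G.src = x := by
  rw [Category.assoc, G.isGroupoid.unit_src, Category.comp_id]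

@[simp] lemma comp_unit_tgt (x : S ⟶ G.obj) : (x ≫ G.unit) ≫ G.tgt = x := by
  rw [Category.assoc, G.isGroupoid.unit_tgt, Category.comp_id]

lemma mul_assoc (γ η ζ : S ⟶ G.arr) (h : γ ≫ G.src = η ≫ G.tgt)
    (h' : G.mul γ η h ≫ G.src = ζ ≫ G.tgt) :
    G.mul (G.mul γ η h) ζ h' =
      G.mul γ (G.mul η ζ ((G.mul_src γ η h).symm.trans h')) (by rw [mul_tgt, h]) :=
  G.isGroupoid.mul_assoc γ η ζ h ((G.mul_src γ η h).symm.trans h')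

lemma inv_mul_cancel_left (γ η : S ⟶ G.arr) (h : γ ≫ G.src = η ≫ G.tgt)
    (h' : (γ ≫ G.inv) ≫ G.src = G.mul γ η h ≫ G.tgt) :
    G.mul (γ ≫ G.inv) (G.mul γ η h) h' = η := by
  have := G.mul_assoc (γ ≫ G.inv) γ η (G.comp_inv_src γ) ((G.mul_src _ _ _).trans h)
  rw [← this]
  simp only [inv_mul, unit_mul]

/-- A right inverse is the inverse. -/
lemma eq_inv_of_mul (γ η : S ⟶ G.arr) (h : γ ≫ G.src = η ≫ G.tgt)
    (e : G.mul γ η h = (γ ≫ G.tgt) ≫ G.unit) : η = γ ≫ G.inv := by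
  have := G.inv_mul_cancel_left γ η h ((G.comp_inv_src γ).trans (G.mul_tgt _ _ _).symm)
  simp only [e, mul_unit] at this
  exact this.symm

lemma inv_inv : G.inv ≫ G.inv = 𝟙 G.arr := by
  refine (G.eq_inv_of_mul (G.inv) (𝟙 _) (by simp [G.isGroupoid.inv_src]) ?_).symm
  rw [G.isGroupoid.inv_mul, G.isGroupoid.inv_tgt]

lemma src_admissible [T.HasIsos] [T.IsStableUnderComposition] : AdmissibleEpi T G.src := by
  have : IsIso G.inv := ⟨G.inv, G.inv_inv, G.inv_inv⟩
  rw [← G.isGroupoid.inv_tgt]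
  exact (AdmissibleEpi.of_isIso T G.inv).comp G.tgt_admissible

end Elements

/-- Strict arrows, i.e. internal functors. -/
@[ext]
structure Hom (H G : InternalGroupoid T) where
  obj : H.obj ⟶ G.obj
  arr : H.arr ⟶ G.arr
  arr_src : arr ≫ G.src = H.src ≫ obj
  arr_tgt : arr ≫ G.tgt = H.tgt ≫ obj
  inv_arr : H.inv ≫ arr = arr ≫ G.inv
  m_arr : H.m ≫ arr = G.mul (H.fst ≫ arr) (H.snd ≫ arr)
    (by simp only [Category.assoc, arr_src, arr_tgt, reassoc_of% H.isPullback.w])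

instance : Category (InternalGroupoid T) where
  Hom := Hom
  id G :=
    { obj := 𝟙 _
      arr := 𝟙 _
      arr_src := by simp
      arr_tgt := by simp
      inv_arr := by simp
      m_arr := by
        have : G.isPullback.lift G.fst G.snd G.isPullback.w = 𝟙 _ := by
          apply G.isPullback.hom_ext <;> simp
        simp [GroupoidData.mul, this] }
  comp f g :=
    { obj := f.obj ≫ g.obj
      arr := f.arr ≫ g.arr
      arr_src := by rw [Category.assoc, g.arr_src, reassoc_of% f.arr_src]
      arr_tgt := by rw [Category.assoc, g.arr_tgt, reassoc_of% f.arr_tgt]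
      inv_arr := by rw [Category.assoc, ← g.inv_arr, reassoc_of% f.inv_arr]
      m_arr := by
        rw [reassoc_of% f.m_arr, GroupoidData.mul, Category.assoc, g.m_arr, comp_mul]
        simp }
  id_comp f := Hom.ext (Category.id_comp _) (Category.id_comp _)
  comp_id f := Hom.ext (Category.comp_id _) (Category.comp_id _)
  assoc f g h := Hom.ext (Category.assoc _ _ _) (Category.assoc _ _ _)

/-! ## The cocylinder and homotopies

The interval `I` is the groupoid with two objects and exactly one arrow between any two of them.
The cocylinder `G^I` is the groupoid of arrows of `G`: an object is an arrow `σ` of `G`, and an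
arrow from `σ` to `σ'` is a commutative square, given by `(a, σ, b)` with `s a = s σ`, `s b = r σ`
and then `σ' = b · σ · a⁻¹`. -/

section Cocylinder

variable [T.HasIsos] [T.IsStableUnderComposition] (G : InternalGroupoid T)

instance : HasPullback G.src G.src := G.src_admissible.1 G.src

instance : HasPullback (pullback.snd G.src G.src ≫ G.tgt) G.src :=
  haveI := G.src_admissible.1 (pullback.snd G.src G.src ≫ G.tgt)
  hasPullback_symmetry _ _

/-- The object of squares `(a, σ, b)`. -/
noncomputable abbrev Sq : A := pullback (pullback.snd G.src G.src ≫ G.tgt) G.src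

/-- The component `a` of a square. -/
noncomputable def sqA : G.Sq ⟶ G.arr := pullback.fst _ _ ≫ pullback.fst _ _

/-- The component `σ` of a square. -/
noncomputable def sqσ : G.Sq ⟶ G.arr := pullback.fst _ _ ≫ pullback.snd _ _

/-- The component `b` of a square. -/
noncomputable def sqB : G.Sq ⟶ G.arr := pullback.snd _ _

lemma sqA_src : G.sqA ≫ G.src = G.sqσ ≫ G.src := by
  simp only [sqA, sqσ, Category.assoc, pullback.condition]

lemma sqB_src : G.sqB ≫ G.src = G.sqσ ≫ G.tgt := by
  simp only [sqB, sqσ, Category.assoc]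
  exact pullback.condition.symm

lemma sqσ_admissible : AdmissibleEpi T G.sqσ :=
  (G.src_admissible.of_isPullback
    (IsPullback.of_hasPullback (pullback.snd G.src G.src ≫ G.tgt) G.src).flip).comp
    (G.src_admissible.of_isPullback (IsPullback.of_hasPullback G.src G.src))

variable {G} {S : A}

/-- The square with components `(a, σ, b)`. -/
noncomputable def sqLift (a σ b : S ⟶ G.arr) (ha : a ≫ G.src = σ ≫ G.src)
    (hb : b ≫ G.src = σ ≫ G.tgt) : S ⟶ G.Sq :=
  pullback.lift (pullback.lift a σ ha) b (by
    rw [← Category.assoc, pullback.lift_snd]; exact hb.symm)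

section
variable (a σ b : S ⟶ G.arr) (ha : a ≫ G.src = σ ≫ G.src) (hb : b ≫ G.src = σ ≫ G.tgt)

@[simp] lemma sqLift_sqA : sqLift a σ b ha hb ≫ G.sqA = a := by
  simp [sqLift, sqA, pullback.lift_fst_assoc, pullback.lift_fst]

@[simp] lemma sqLift_sqσ : sqLift a σ b ha hb ≫ G.sqσ = σ := by
  simp [sqLift, sqσ, pullback.lift_fst_assoc, pullback.lift_snd]

@[simp] lemma sqLift_sqB : sqLift a σ b ha hb ≫ G.sqB = b := by
  simp [sqLift, sqB, pullback.lift_snd]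

end

lemma sq_hom_ext {f g : S ⟶ G.Sq} (h₁ : f ≫ G.sqA = g ≫ G.sqA) (h₂ : f ≫ G.sqσ = g ≫ G.sqσ)
    (h₃ : f ≫ G.sqB = g ≫ G.sqB) : f = g := by
  apply pullback.hom_ext
  · apply pullback.hom_ext
    · simpa [sqA] using h₁
    · simpa [sqσ] using h₂
  · exact h₃

variable (G)

/-- The far side `b · σ · a⁻¹` of a square. -/
noncomputable def sqτ : G.Sq ⟶ G.arr :=
  G.mul (G.mul G.sqB G.sqσ G.sqB_src) (G.sqA ≫ G.inv)
    (by rw [mul_src, comp_inv_tgt, sqA_src])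

variable {G} in
/-- `f ≫ sqτ` is determined by the equation `τ · a = b · σ`. -/
lemma comp_sqτ_eq (f : S ⟶ G.Sq) (τ : S ⟶ G.arr) (h : τ ≫ G.src = (f ≫ G.sqA) ≫ G.tgt)
    (e : G.mul τ (f ≫ G.sqA) h = G.mul (f ≫ G.sqB) (f ≫ G.sqσ)
      (by simp only [Category.assoc, sqB_src])) : f ≫ G.sqτ = τ := by
  have h₁ := G.mul_assoc τ (f ≫ G.sqA) ((f ≫ G.sqA) ≫ G.inv) h
    (by rw [mul_src, comp_inv_tgt])
  simp only [e, mul_inv] at h₁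
  rw [mul_unit] at h₁
  rw [← h₁, sqτ]
  simp only [comp_mul, Category.assoc]

lemma sqτ_src : G.sqτ ≫ G.src = G.sqA ≫ G.tgt := by
  rw [sqτ, mul_src, comp_inv_src]

lemma sqτ_tgt : G.sqτ ≫ G.tgt = G.sqB ≫ G.tgt := by
  rw [sqτ, mul_tgt, mul_tgt]

lemma sqτ_mul (f : S ⟶ G.Sq) (h : (f ≫ G.sqτ) ≫ G.src = (f ≫ G.sqA) ≫ G.tgt) :
    G.mul (f ≫ G.sqτ) (f ≫ G.sqA) h = G.mul (f ≫ G.sqB) (f ≫ G.sqσ)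
      (by simp only [Category.assoc, sqB_src]) := by
  have h₁ := G.mul_assoc (G.mul (f ≫ G.sqB) (f ≫ G.sqσ)
      (by simp only [Category.assoc, sqB_src])) ((f ≫ G.sqA) ≫ G.inv) (f ≫ G.sqA)
      (by rw [mul_src, comp_inv_tgt, Category.assoc, Category.assoc, sqA_src])
      (by rw [mul_src, comp_inv_src])
  simp only [inv_mul] at h₁
  rw [mul_unit] at h₁
  rw [← h₁]
  congr 1
  simp only [sqτ, comp_mul, Category.assoc]

variable {G} in
/-- Composition of squares. -/
noncomputable def sqMul (f g : S ⟶ G.Sq) (h : f ≫ G.sqσ = g ≫ G.sqτ) : S ⟶ G.Sq :=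
  sqLift
    (G.mul (f ≫ G.sqA) (g ≫ G.sqA) (by
      rw [Category.assoc, sqA_src, Category.assoc, ← sqτ_src, reassoc_of% h]))
    (g ≫ G.sqσ)
    (G.mul (f ≫ G.sqB) (g ≫ G.sqB) (by
      rw [Category.assoc, sqB_src, Category.assoc, ← sqτ_tgt, reassoc_of% h]))
    (by rw [mul_src, Category.assoc, sqA_src, Category.assoc])
    (by rw [mul_src, Category.assoc, sqB_src, Category.assoc])

/-- The constant squares. -/
noncomputable def sqUnit : G.arr ⟶ G.Sq :=
  sqLift (G.src ≫ G.unit) (𝟙 _) (G.tgt ≫ G.unit) (by simp [G.isGroupoid.unit_src])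
    (by simp [G.isGroupoid.unit_src])

/-- The inverse squares. -/
noncomputable def sqInv : G.Sq ⟶ G.Sq :=
  sqLift (G.sqA ≫ G.inv) G.sqτ (G.sqB ≫ G.inv) (by rw [comp_inv_src, sqτ_src])
    (by rw [comp_inv_src, sqτ_tgt])

variable {G} in
lemma comp_sqMul {S' : A} (k : S' ⟶ S) (f g : S ⟶ G.Sq) (h : f ≫ G.sqσ = g ≫ G.sqτ) :
    k ≫ sqMul f g h = sqMul (k ≫ f) (k ≫ g) (by simp only [Category.assoc, h]) := by
  apply sq_hom_ext <;> simp only [sqMul, Category.assoc, sqLift_sqA, sqLift_sqσ, sqLift_sqB,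
    comp_mul]

lemma sqUnit_sqτ : G.sqUnit ≫ G.sqτ = 𝟙 G.arr := by
  apply comp_sqτ_eq
  · simp only [sqUnit, sqLift_sqA, sqLift_sqB, sqLift_sqσ]
    rw [G.mul_unit, G.unit_mul]
  · simp only [sqUnit, sqLift_sqA]
    rw [comp_unit_tgt, Category.id_comp]

lemma sqUnit_sqσ : G.sqUnit ≫ G.sqσ = 𝟙 G.arr := by
  simp only [sqUnit, sqLift_sqσ]

lemma sqInv_sqA : G.sqInv ≫ G.sqA = G.sqA ≫ G.inv := by
  simp only [sqInv, sqLift_sqA]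

lemma sqInv_sqB : G.sqInv ≫ G.sqB = G.sqB ≫ G.inv := by
  simp only [sqInv, sqLift_sqB]

lemma sqInv_sqσ : G.sqInv ≫ G.sqσ = G.sqτ := by
  simp only [sqInv, sqLift_sqσ]

lemma sqInv_sqτ : G.sqInv ≫ G.sqτ = G.sqσ := by
  have e := G.sqτ_mul (𝟙 _) (by simp [sqτ_src])
  simp only [Category.id_comp] at e
  apply comp_sqτ_eq
  · simp only [sqInv, sqLift_sqA, sqLift_sqB, sqLift_sqσ]
    have h₁ := G.inv_mul_cancel_left G.sqB G.sqσ G.sqB_src (by rw [comp_inv_src, mul_tgt])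
    simp only [← e] at h₁
    have h₂ := G.mul_assoc (G.sqB ≫ G.inv) G.sqτ G.sqA
      (by rw [comp_inv_src, sqτ_tgt]) (by rw [mul_src, sqτ_src])
    rw [h₁] at h₂
    have h₃ := G.mul_assoc (G.mul (G.sqB ≫ G.inv) G.sqτ (by rw [comp_inv_src, sqτ_tgt]))
      G.sqA (G.sqA ≫ G.inv) (by rw [mul_src, sqτ_src]) (by rw [mul_src, comp_inv_tgt])
    simp only [h₂, mul_inv] at h₃
    rw [h₃, mul_unit]
  · simp only [sqInv, sqLift_sqA]
    rw [comp_inv_tgt, sqA_src]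

variable {G}

lemma sqMul_sqσ (f g : S ⟶ G.Sq) (h : f ≫ G.sqσ = g ≫ G.sqτ) :
    sqMul f g h ≫ G.sqσ = g ≫ G.sqσ := by
  simp [sqMul]

lemma sqMul_sqτ (f g : S ⟶ G.Sq) (h : f ≫ G.sqσ = g ≫ G.sqτ) :
    sqMul f g h ≫ G.sqτ = f ≫ G.sqτ := by
  have hA : (f ≫ G.sqA) ≫ G.src = (g ≫ G.sqA) ≫ G.tgt := by
    rw [Category.assoc, sqA_src, Category.assoc, ← sqτ_src, reassoc_of% h]
  have hB : (f ≫ G.sqB) ≫ G.src = (g ≫ G.sqB) ≫ G.tgt := by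
    rw [Category.assoc, sqB_src, Category.assoc, ← sqτ_tgt, reassoc_of% h]
  have hf : (f ≫ G.sqτ) ≫ G.src = (f ≫ G.sqA) ≫ G.tgt := by
    rw [Category.assoc, sqτ_src, Category.assoc]
  have hg : (g ≫ G.sqτ) ≫ G.src = (g ≫ G.sqA) ≫ G.tgt := by
    rw [Category.assoc, sqτ_src, Category.assoc]
  have hf' : (f ≫ G.sqB) ≫ G.src = (f ≫ G.sqσ) ≫ G.tgt := by
    rw [Category.assoc, sqB_src, Category.assoc]
  have h₁ := G.mul_assoc (f ≫ G.sqτ) (f ≫ G.sqA) (g ≫ G.sqA) hf (by rw [mul_src, hA])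
  have h₂ := G.mul_assoc (f ≫ G.sqB) (f ≫ G.sqσ) (g ≫ G.sqA) hf'
    (by rw [mul_src, h, hg])
  have h₃ := G.mul_assoc (f ≫ G.sqB) (g ≫ G.sqB) (g ≫ G.sqσ) hB
    (by rw [mul_src, Category.assoc, sqB_src, Category.assoc])
  have ef := G.sqτ_mul f hf
  have eg := G.sqτ_mul g hg
  apply comp_sqτ_eq
  · simp only [sqMul, sqLift_sqA, sqLift_sqB, sqLift_sqσ]
    rw [h₃, ← h₁]
    simp only [ef, ← eg, ← h]
    exact h₂
  · rw [sqMul, sqLift_sqA, mul_tgt, hf]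

lemma sqMul_assoc (f g k : S ⟶ G.Sq) (h : f ≫ G.sqσ = g ≫ G.sqτ) (h' : g ≫ G.sqσ = k ≫ G.sqτ) :
    sqMul (sqMul f g h) k ((sqMul_sqσ f g h).trans h') =
      sqMul f (sqMul g k h') (h.trans (sqMul_sqτ g k h').symm) := by
  apply sq_hom_ext
  · simp only [sqMul, sqLift_sqA]
    exact G.mul_assoc _ _ _ _ _
  · simp only [sqMul, sqLift_sqσ]
  · simp only [sqMul, sqLift_sqB]
    exact G.mul_assoc _ _ _ _ _

variable (G)

lemma sqUnit_sqMul (h : (G.sqτ ≫ G.sqUnit) ≫ G.sqσ = 𝟙 G.Sq ≫ G.sqτ) :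
    sqMul (G.sqτ ≫ G.sqUnit) (𝟙 _) h = 𝟙 _ := by
  apply sq_hom_ext
  · simp only [sqMul, sqUnit, Category.assoc, sqLift_sqA]
    simp only [← Category.assoc, unit_mul]
  · simp [sqMul]
  · simp only [sqMul, sqUnit, Category.assoc, sqLift_sqB]
    simp only [← Category.assoc, unit_mul]

lemma sqMul_sqUnit (h : 𝟙 G.Sq ≫ G.sqσ = (G.sqσ ≫ G.sqUnit) ≫ G.sqτ) :
    sqMul (𝟙 _) (G.sqσ ≫ G.sqUnit) h = 𝟙 _ := by
  apply sq_hom_ext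
  · simp only [sqMul, sqUnit, Category.assoc, sqLift_sqA]
    simp only [← Category.assoc, mul_unit]
  · simp [sqMul, sqUnit]
  · simp only [sqMul, sqUnit, Category.assoc, sqLift_sqB]
    simp only [← Category.assoc, mul_unit]

lemma sqInv_sqMul (h : G.sqInv ≫ G.sqσ = 𝟙 G.Sq ≫ G.sqτ) :
    sqMul G.sqInv (𝟙 _) h = G.sqσ ≫ G.sqUnit := by
  apply sq_hom_ext
  · simp only [sqMul, sqInv, sqUnit, Category.assoc, sqLift_sqA, Category.id_comp, inv_mul,
      sqA_src]
  · simp [sqMul, sqUnit]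
  · simp only [sqMul, sqInv, sqUnit, Category.assoc, sqLift_sqB, Category.id_comp, inv_mul]
    simp only [← Category.assoc, sqB_src]

lemma sqMul_sqInv (h : 𝟙 G.Sq ≫ G.sqσ = G.sqInv ≫ G.sqτ) :
    sqMul (𝟙 _) G.sqInv h = G.sqτ ≫ G.sqUnit := by
  apply sq_hom_ext
  · simp only [sqMul, sqInv, sqUnit, Category.assoc, sqLift_sqA, Category.id_comp, mul_inv]
    simp only [← Category.assoc, sqτ_src]
  · simp [sqMul, sqUnit, sqInv]
  · simp only [sqMul, sqInv, sqUnit, Category.assoc, sqLift_sqB, Category.id_comp, mul_inv]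
    simp only [← Category.assoc, sqτ_tgt]

instance : HasPullback G.sqσ G.sqτ := G.sqσ_admissible.1 G.sqτ

/-- The structure maps of `G^I`. -/
noncomputable def pathData : GroupoidData A where
  obj := G.arr
  arr := G.Sq
  src := G.sqσ
  tgt := G.sqτ
  unit := G.sqUnit
  inv := G.sqInv
  pairs := pullback G.sqσ G.sqτ
  fst := pullback.fst _ _
  snd := pullback.snd _ _
  isPullback := IsPullback.of_hasPullback _ _
  m := sqMul (pullback.fst _ _) (pullback.snd _ _) pullback.condition

variable {G} in
lemma pathData_mul (f g : S ⟶ G.Sq) (h : f ≫ G.sqσ = g ≫ G.sqτ) :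
    G.pathData.mul f g h = sqMul f g h := by
  refine (comp_sqMul (G := G) (G.pathData.isPullback.lift f g h) _ _ pullback.condition).trans ?_
  congr 1
  · exact G.pathData.isPullback.lift_fst f g h
  · exact G.pathData.isPullback.lift_snd f g h

lemma pathData_isGroupoid : G.pathData.IsGroupoid where
  unit_src := G.sqUnit_sqσ
  unit_tgt := G.sqUnit_sqτ
  inv_src := G.sqInv_sqσ
  inv_tgt := G.sqInv_sqτ
  m_src := sqMul_sqσ _ _ pullback.condition
  m_tgt := sqMul_sqτ _ _ pullback.condition
  unit_mul :=
    have h : (G.sqτ ≫ G.sqUnit) ≫ G.sqσ = 𝟙 G.Sq ≫ G.sqτ := by simp [sqUnit_sqσ]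
    (pathData_mul _ _ h).trans (G.sqUnit_sqMul h)
  mul_unit :=
    have h : 𝟙 G.Sq ≫ G.sqσ = (G.sqσ ≫ G.sqUnit) ≫ G.sqτ := by simp [sqUnit_sqτ]
    (pathData_mul _ _ h).trans (G.sqMul_sqUnit h)
  inv_mul :=
    have h : G.sqInv ≫ G.sqσ = 𝟙 G.Sq ≫ G.sqτ := by simp [sqInv_sqσ]
    (pathData_mul _ _ h).trans (G.sqInv_sqMul h)
  mul_inv :=
    have h : 𝟙 G.Sq ≫ G.sqσ = G.sqInv ≫ G.sqτ := by simp [sqInv_sqτ]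
    (pathData_mul _ _ h).trans (G.sqMul_sqInv h)
  mul_assoc := by
    intro S f g k h h'
    have e (f f' g g' : S ⟶ G.Sq) (hf : f = f') (hg : g = g') (h : f ≫ G.sqσ = g ≫ G.sqτ)
        (h' : f' ≫ G.sqσ = g' ≫ G.sqτ) : G.pathData.mul f g h = sqMul f' g' h' := by
      subst hf hg; exact pathData_mul f g h
    exact (e _ _ _ _ (pathData_mul f g h) rfl _ ((sqMul_sqσ f g h).trans h')).trans
      ((sqMul_assoc f g k h h').trans (e _ _ _ _ rfl (pathData_mul g k h') _
        (h.trans (sqMul_sqτ g k h').symm)).symm)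

/-- The cocylinder `G^I`. -/
noncomputable def path : InternalGroupoid T where
  toGroupoidData := G.pathData
  isGroupoid := G.pathData_isGroupoid
  tgt_admissible := by
    have hii : G.sqInv ≫ G.sqInv = 𝟙 _ := by
      apply sq_hom_ext
      · rw [Category.assoc, sqInv_sqA, reassoc_of% G.sqInv_sqA, G.inv_inv, Category.comp_id,
          Category.id_comp]
      · rw [Category.assoc, sqInv_sqσ, sqInv_sqτ, Category.id_comp]
      · rw [Category.assoc, sqInv_sqB, reassoc_of% G.sqInv_sqB, G.inv_inv, Category.comp_id,
          Category.id_comp]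
    have : IsIso G.sqInv := ⟨G.sqInv, hii, hii⟩
    have h := (AdmissibleEpi.of_isIso T G.sqInv).comp G.sqσ_admissible
    rwa [sqInv_sqσ] at h

/-- The end-point projection `e₀ : G^I ⟶ G`, `σ ↦ s σ`. -/
noncomputable def e₀ : G.path ⟶ G where
  obj := G.src
  arr := G.sqA
  arr_src := G.sqA_src
  arr_tgt := G.sqτ_src.symm
  inv_arr := G.sqInv_sqA
  m_arr := by
    change sqMul _ _ pullback.condition ≫ G.sqA = _
    rw [sqMul, sqLift_sqA]
    rfl

/-- The end-point projection `e₁ : G^I ⟶ G`, `σ ↦ r σ`. -/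
noncomputable def e₁ : G.path ⟶ G where
  obj := G.tgt
  arr := G.sqB
  arr_src := G.sqB_src
  arr_tgt := G.sqτ_tgt.symm
  inv_arr := G.sqInv_sqB
  m_arr := by
    change sqMul _ _ pullback.condition ≫ G.sqB = _
    rw [sqMul, sqLift_sqB]
    rfl

variable {G} {H : InternalGroupoid T}

/-- Right homotopy `φ ∼_h ψ`: a strict arrow `H ⟶ G^I` with end points `φ` and `ψ`. -/
def RightHomotopic (φ ψ : H ⟶ G) : Prop :=
  ∃ h : H ⟶ G.path, h ≫ G.e₀ = φ ∧ h ≫ G.e₁ = ψ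

/-- `φ ∼_n ψ`: a chain of `n` right homotopies from `φ` to `ψ`. -/
def HomotopicIn : ℕ → (H ⟶ G) → (H ⟶ G) → Prop
  | 0, φ, ψ => φ = ψ
  | n + 1, φ, ψ => ∃ χ, HomotopicIn n φ χ ∧ RightHomotopic χ ψ

/-- Strong homotopy: `φ ∼_n ψ` for some `n`. -/
def StronglyHomotopic (φ ψ : H ⟶ G) : Prop :=
  ∃ n, HomotopicIn n φ ψ

/-- Strong homotopy equivalences. -/
def StrongHomotopyEquiv (h : H ⟶ G) : Prop :=
  ∃ k : G ⟶ H, StronglyHomotopic (h ≫ k) (𝟙 H) ∧ StronglyHomotopic (k ≫ h) (𝟙 G)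

end Cocylinder

/-! ## Essential (homotopy) equivalences -/

/-- `ε` is fully faithful: `H₁` is the pullback of `s ⊕ r : G₁ ⟶ G₀ × G₀` along `ε × ε`. -/
def FullyFaithful {H G : InternalGroupoid T} (ε : H ⟶ G) : Prop :=
  ∀ ⦃S : A⦄ (x y : S ⟶ H.obj) (γ : S ⟶ G.arr),
    γ ≫ G.src = x ≫ ε.obj → γ ≫ G.tgt = y ≫ ε.obj →
    ∃! η : S ⟶ H.arr, η ≫ H.src = x ∧ η ≫ H.tgt = y ∧ η ≫ ε.arr = γ

/-- `ε` is essentially surjective: `r ∘ pr₁ : G₁ * H₀ ⟶ G₀` is an admissible epimorphism. -/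
def EssentiallySurjective {H G : InternalGroupoid T} (ε : H ⟶ G) : Prop :=
  ∃ (P : A) (p₁ : P ⟶ G.arr) (p₂ : P ⟶ H.obj),
    IsPullback p₁ p₂ G.src ε.obj ∧ AdmissibleEpi T (p₁ ≫ G.tgt)

/-- Essential equivalences of internal groupoids. -/
def EssentialEquiv {H G : InternalGroupoid T} (ε : H ⟶ G) : Prop :=
  EssentiallySurjective ε ∧ FullyFaithful ε

section Localization

variable [T.HasIsos] [T.IsStableUnderComposition]

/-- The class `W` of essential homotopy equivalences: up to strong homotopy, `η` is a strong
homotopy equivalence followed by an essential equivalence. -/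
def EssentialHomotopyEquiv {K G : InternalGroupoid T} (η : K ⟶ G) : Prop :=
  ∃ (L : InternalGroupoid T) (h : K ⟶ L) (ε : L ⟶ G),
    StrongHomotopyEquiv h ∧ EssentialEquiv ε ∧ StronglyHomotopic η (h ≫ ε)

/-! ## The localized bicategory -/

/-- A pair of strict arrows `K ⟵ J ⟶ G`. -/
structure Span (K G : InternalGroupoid T) where
  apex : InternalGroupoid T
  left : apex ⟶ K
  right : apex ⟶ G

/-- The `1`-arrows of the localized bicategory: the left leg is in `W`. -/
def Span.IsFraction {K G : InternalGroupoid T} (F : Span K G) : Prop :=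
  EssentialHomotopyEquiv F.left

/-- Bi-maps: the left leg is an essential equivalence. -/
def Span.IsBimap {K G : InternalGroupoid T} (F : Span K G) : Prop :=
  EssentialEquiv F.left

/-- The span `K ⟵ K ⟶ G` given by a strict arrow. -/
def Span.ofHom {K G : InternalGroupoid T} (φ : K ⟶ G) : Span K G where
  apex := K
  left := 𝟙 K
  right := φ

/-- Morita homotopy, i.e. existence of a `2`-arrow of the localized bicategory: strict
arrows `u`, `v` in `W` from some `L` to the two apexes such that both triangles commute up to
strong homotopy. -/
def MoritaHomotopic {K G : InternalGroupoid T} (F F' : Span K G) : Prop :=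
  ∃ (L : InternalGroupoid T) (u : L ⟶ F.apex) (v : L ⟶ F'.apex),
    EssentialHomotopyEquiv u ∧ EssentialHomotopyEquiv v ∧
    StronglyHomotopic (u ≫ F.left) (v ≫ F'.left) ∧
    StronglyHomotopic (u ≫ F.right) (v ≫ F'.right)

/-- `P` with its projections is the homotopy pullback `P₁` of `K ⟶ G ⟵ J`: its objects are
the triples `(x, σ, y)` with `σ : φ x ⟶ ψ y` in `G`, and its arrows with source `(x, σ, y)` are
the triples `(κ, σ, ι)` where `κ` and `ι` have source `x` and `y`. -/
def IsHomotopyPullback {K J G P : InternalGroupoid T} (φ : K ⟶ G) (ψ : J ⟶ G)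
    (p : P ⟶ K) (q : P ⟶ J) : Prop :=
  ∃ h : P ⟶ G.path, h ≫ G.e₀ = p ≫ φ ∧ h ≫ G.e₁ = q ≫ ψ ∧
    (∀ ⦃S : A⦄ (x : S ⟶ K.obj) (σ : S ⟶ G.path.obj) (y : S ⟶ J.obj),
      σ ≫ G.e₀.obj = x ≫ φ.obj → σ ≫ G.e₁.obj = y ≫ ψ.obj →
      ∃! z : S ⟶ P.obj, z ≫ p.obj = x ∧ z ≫ h.obj = σ ∧ z ≫ q.obj = y) ∧
    (∀ ⦃S : A⦄ (κ : S ⟶ K.arr) (σ : S ⟶ G.path.obj) (ι : S ⟶ J.arr),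
      σ ≫ G.e₀.obj = (κ ≫ K.src) ≫ φ.obj → σ ≫ G.e₁.obj = (ι ≫ J.src) ≫ ψ.obj →
      ∃! z : S ⟶ P.arr, z ≫ p.arr = κ ∧ z ≫ P.src ≫ h.obj = σ ∧ z ≫ q.arr = ι)

/-- `P` with its projections is the `(n + 1)`-st homotopy pullback of `K ⟶ G ⟵ J`, obtained by
iterating the homotopy pullback through `n` copies of `G`. -/
def IsIteratedHomotopyPullback {K G : InternalGroupoid T} (φ : K ⟶ G) :
    ℕ → ∀ {J P : InternalGroupoid T}, (J ⟶ G) → (P ⟶ K) → (P ⟶ J) → Prop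
  | 0, _, _, ψ, p, q => IsHomotopyPullback φ ψ p q
  | n + 1, _, P, ψ, p, q => ∃ (Q : InternalGroupoid T) (p' : Q ⟶ K) (q' : Q ⟶ G) (f : P ⟶ Q),
      IsIteratedHomotopyPullback φ n (𝟙 G) p' q' ∧ IsHomotopyPullback q' ψ f q ∧ p = f ≫ p'

/-- `C` is a horizontal composite of `F` and `F'`, formed with an iterated homotopy pullback. -/
def IsComposite {K G L : InternalGroupoid T} (F : Span K G) (F' : Span G L) (C : Span K L) :
    Prop :=
  ∃ (n : ℕ) (p : C.apex ⟶ F.apex) (q : C.apex ⟶ F'.apex),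
    IsIteratedHomotopyPullback F.right n F'.left p q ∧
    C.left = p ≫ F.left ∧ C.right = q ≫ F'.right

/-- `K ∼_W G`: equivalence of objects in the localized bicategory. There are `1`-arrows in both
directions whose two composites are Morita homotopic to the identities. -/
def WEquivalent (K G : InternalGroupoid T) : Prop :=
  ∃ (F : Span K G) (F' : Span G K) (C : Span K K) (D : Span G G),
    F.IsFraction ∧ F'.IsFraction ∧ IsComposite F F' C ∧ IsComposite F' F D ∧
    MoritaHomotopic C (Span.ofHom (𝟙 K)) ∧ MoritaHomotopic D (Span.ofHom (𝟙 G))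

/-! ## Geometric complexity -/

/-- Point groupoids `K ⋉ • ⇉ •`: internal groups, viewed as groupoids over a terminal object. -/
def IsPointGroupoid (P : InternalGroupoid T) : Prop :=
  Nonempty (IsTerminal P.obj)

/-- Constant bi-maps: bi-maps whose right leg takes its values in a point groupoid. -/
def Span.IsConstant {K G : InternalGroupoid T} (F : Span K G) : Prop :=
  F.IsBimap ∧ ∃ (P : InternalGroupoid T) (c : F.apex ⟶ P) (j : P ⟶ G),
    IsPointGroupoid P ∧ F.right = c ≫ j

/-- The full subgroupoid of `G` over an invariant subobject `U ⟶ G₀`, i.e. a subobject that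
contains the range of each arrow of `G` whose source it contains. -/
structure InvariantSubgroupoid (G : InternalGroupoid T) where
  grpd : InternalGroupoid T
  incl : grpd ⟶ G
  mono : Mono incl.obj
  fullyFaithful : FullyFaithful incl
  invariant : ∀ ⦃S : A⦄ (γ : S ⟶ G.arr) (x : S ⟶ grpd.obj), x ≫ incl.obj = γ ≫ G.src →
    ∃ y : S ⟶ grpd.obj, y ≫ incl.obj = γ ≫ G.tgt

/-- Weak point subgroupoids: the inclusion is Morita homotopic to a constant bi-map. -/
def InvariantSubgroupoid.IsWeakPoint {G : InternalGroupoid T} (U : InvariantSubgroupoid G) :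
    Prop :=
  ∃ F : Span U.grpd G, F.IsConstant ∧ MoritaHomotopic (Span.ofHom U.incl) F

/-- The geometric complexity: the least number `n` such that `n` weak point subgroupoids
cover `G`, i.e. their objects form a cover of `G₀` in the site; it is `∞` if there is no such `n`. -/
noncomputable def cgeo (G : InternalGroupoid T) : ℕ∞ :=
  ⨅ (n : ℕ) (_ : ∃ U : Fin n → InvariantSubgroupoid G, (∀ k, (U k).IsWeakPoint) ∧
    Presieve.ofArrows (fun k => (U k).grpd.obj) (fun k => (U k).incl.obj) ∈ T G.obj), (n : ℕ∞)

end Localization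

end InternalGroupoid
end AbsoluteGeometry

/-!
The class `W` turns out to consist of the essential equivalences, and this reduces the invariance
of the geometric complexity to elementary statements about generalized elements of groupoids.

An arrow into the cocylinder is a natural transformation between its end points, so strong
homotopy is natural isomorphy (`stronglyHomotopic_iff`). Effective descent glues representing
objects (`EffectiveDescent.representedOver`), hence a locally liftable arrow is an admissible
epimorphism as soon as its base changes exist locally (`AdmissibleEpi.of_locally`). For a fully
faithful strict arrow they do: over a stage on which the objects of the codomain have preimages,
they are base changes of the range map of the domain. Thus a strict arrow is an essential
equivalence as soon as it is fully faithful and locally essentially surjective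
(`EssentialEquiv.of_locallyEssSurj`), which gives closure under composition and homotopy, and
covers the strong homotopy equivalences (`essentialHomotopyEquiv_iff`). Essential equivalences
can be pulled back along strict arrows (`EssentialEquiv.exists_pullback`), by inducing a groupoid
along an admissible epimorphism and lifting strict arrows through fully faithful ones.

Now let `M ⟵ J ⟶ N`, with legs `η` and `φ`, have an inverse span in the localized bicategory, and
let `U` be an invariant subobject of `N₀` that is a member of a cover. The objects `m` of `M` such
that `φ x` lies in `U` whenever `η x` is isomorphic to `m` form an invariant subobject of `M₀`:
locally on `M₀` it is a base change of `U`, and effective descent glues the pieces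
(`exists_transported`). Covers go to covers because being a cover is local
(`transported_cover`). If the inclusion of `U` factors through a point groupoid up to `W`, then
that point lifts along the left leg of the inverse span because points lift along admissible
epimorphisms. Its image in `M` is the point required for the transported subobject, since the
composite of the two spans is Morita homotopic to the identity
(`InvariantSubgroupoid.IsWeakPoint.transport`). This shows one inequality (`cgeo_le`), and the
situation is symmetric.
-/

namespace AbsoluteGeometry

variable {A : Type u} [Category.{v} A] {T : Precoverage A}

/-! ### Locality and gluing in the site -/

section Site

lemma isPullback_of_existsUnique {P S Y X : A} {p : P ⟶ S} {q : P ⟶ Y} {f : S ⟶ X} {g : Y ⟶ X}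
    (w : p ≫ f = q ≫ g)
    (h : ∀ ⦃Q : A⦄ (a : Q ⟶ S) (b : Q ⟶ Y), a ≫ f = b ≫ g → ∃! k : Q ⟶ P, k ≫ p = a ∧ k ≫ q = b) :
    IsPullback p q f g := by
  have (s : PullbackCone f g) := h s.fst s.snd s.condition
  choose k hk hu using this
  exact ⟨⟨w⟩, ⟨PullbackCone.IsLimit.mk _ k (fun s => (hk s).1) (fun s => (hk s).2)
    (fun s m h₁ h₂ => hu s m ⟨h₁, h₂⟩)⟩⟩

/-- The base change of a cover, with its comparison squares. -/
lemma exists_cover_pullback [T.HasPullbacks] [T.IsStableUnderBaseChange] {X S : A}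
    {ι : Type*} {U : ι → A} {f : ∀ i, U i ⟶ X} (hf : Presieve.ofArrows U f ∈ T X) (s : S ⟶ X) :
    ∃ (V : ι → A) (p : ∀ i, V i ⟶ S) (q : ∀ i, V i ⟶ U i),
      (∀ i, IsPullback (p i) (q i) s (f i)) ∧ Presieve.ofArrows V p ∈ T S := by
  have (i : ι) : HasPullback s (f i) :=
    have := (T.hasPullbacks_of_mem s hf).hasPullback (Presieve.ofArrows.mk i)
    hasPullback_symmetry (f i) s
  have h (i : ι) := IsPullback.of_hasPullback s (f i)
  exact ⟨_, _, _, h, T.mem_coverings_of_isPullback f hf s _ _ h⟩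

/-- Compatible arrows out of the members of a cover glue in a subcanonical site. -/
lemma IsSubcanonical.exists_glue (hsub : IsSubcanonical T) {X Z : A} {ι : Type*} {U : ι → A}
    {f : ∀ i, U i ⟶ X} (hf : Presieve.ofArrows U f ∈ T X) (x : ∀ i, U i ⟶ Z)
    (hx : ∀ (i j : ι) ⦃S : A⦄ (a : S ⟶ U i) (b : S ⟶ U j), a ≫ f i = b ≫ f j →
      a ≫ x i = b ≫ x j) : ∃ t : X ⟶ Z, ∀ i, f i ≫ t = x i :=
  ((Presieve.isSheafFor_arrows_iff (yoneda.obj Z) _).1 (hsub _ hf Z) x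
    (fun i j _ a b h => hx i j a b h)).exists

lemma IsSubcanonical.hom_ext (hsub : IsSubcanonical T) {X Z : A} {ι : Type*} {U : ι → A}
    {f : ∀ i, U i ⟶ X} (hf : Presieve.ofArrows U f ∈ T X) {t t' : X ⟶ Z}
    (h : ∀ i, f i ≫ t = f i ≫ t') : t = t' :=
  (hsub _ hf Z).isSeparatedFor.ext (by rintro _ _ ⟨i⟩; exact h i)

/-- In a subcanonical site, factoring through a monomorphism is a local property. -/
lemma IsSubcanonical.exists_factor (hsub : IsSubcanonical T) {X Y S : A} (m : Y ⟶ X) [Mono m]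
    {s : S ⟶ X} {ι : Type*} {V : ι → A} {p : ∀ i, V i ⟶ S} (hp : Presieve.ofArrows V p ∈ T S)
    (h : ∀ i, ∃ y : V i ⟶ Y, y ≫ m = p i ≫ s) : ∃ y : S ⟶ Y, y ≫ m = s := by
  choose y hy using h
  obtain ⟨t, ht⟩ := hsub.exists_glue hp y (fun i j S a b hab => by
    rw [← cancel_mono m, Category.assoc, Category.assoc, hy, hy, reassoc_of% hab])
  exact ⟨t, hsub.hom_ext hp fun i => by rw [← hy, reassoc_of% ht]⟩

lemma IsSubcanonical.epi (hsub : IsSubcanonical T) {S X : A} {f : S ⟶ X}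
    (hf : LocallyLiftable T f) : Epi f := by
  obtain ⟨R, hR, hl⟩ := hf
  refine ⟨fun a b hab => ?_⟩
  refine (hsub _ hR _).isSeparatedFor.ext fun U g hg => ?_
  obtain ⟨l, rfl⟩ := hl g hg
  simp [hab]

lemma LocallyLiftable.of_isPullback [T.HasPullbacks] [T.IsStableUnderBaseChange]
    {P S Y X : A} {p : P ⟶ S} {q : P ⟶ Y} {f : S ⟶ X} {g : Y ⟶ X}
    (hf : LocallyLiftable T f) (h : IsPullback p q f g) : LocallyLiftable T q := by
  obtain ⟨R, hR, hl⟩ := hf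
  obtain ⟨ι, U, w, rfl⟩ := R.exists_eq_ofArrows
  obtain ⟨V, a, b, hab, hV⟩ := exists_cover_pullback hR g
  refine ⟨_, hV, ?_⟩
  rintro _ _ ⟨i⟩
  obtain ⟨l, hl⟩ := hl (w i) ⟨i⟩
  exact ⟨h.lift (b i ≫ l) (a i) (by rw [Category.assoc, hl, (hab i).w]), h.lift_snd _ _ _⟩

/-- A predicate `F` on spans `X ⟵ S ⟶ Z` is viewed as a presheaf over `X`. `RepresentedOver F g`
says that the base change of this presheaf along `g : Y ⟶ X` is represented by an object over
`Y`. -/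
def RepresentedOver {X Z : A} (F : ∀ ⦃S : A⦄, (S ⟶ X) → (S ⟶ Z) → Prop) {Y : A} (g : Y ⟶ X) :
    Prop :=
  ∃ (B : A) (b : B ⟶ Y) (c : B ⟶ Z), F (b ≫ g) c ∧
    ∀ ⦃S : A⦄ (s : S ⟶ Y) (z : S ⟶ Z), F (s ≫ g) z → ∃! k : S ⟶ B, k ≫ b = s ∧ k ≫ c = z

/-- Under effective descent, a sheaf over `X` that is representable over the members of a cover is
representable: the local representing objects carry a canonical descent datum. -/
lemma EffectiveDescent.representedOver [T.HasPullbacks] [T.IsStableUnderBaseChange]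
    (hsub : IsSubcanonical T) (hdesc : EffectiveDescent T) {X Z : A}
    (F : ∀ ⦃S : A⦄, (S ⟶ X) → (S ⟶ Z) → Prop)
    (hF : ∀ ⦃S S' : A⦄ (k : S' ⟶ S) (s : S ⟶ X) (z : S ⟶ Z), F s z → F (k ≫ s) (k ≫ z))
    (hloc : ∀ ⦃S : A⦄ (s : S ⟶ X) (z : S ⟶ Z) {ι : Type (max u v)} (V : ι → A)
      (p : ∀ i, V i ⟶ S), Presieve.ofArrows V p ∈ T S → (∀ i, F (p i ≫ s) (p i ≫ z)) → F s z)
    {ι : Type (max u v)} {U : ι → A} {f : ∀ i, U i ⟶ X} (hf : Presieve.ofArrows U f ∈ T X)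
    (hrep : ∀ i, RepresentedOver F (f i)) : RepresentedOver F (𝟙 X) := by
  choose B b c hbc hB using hrep
  have lift_ext (j : ι) {S : A} {k k' : S ⟶ B j} (h₁ : k ≫ b j = k' ≫ b j)
      (h₂ : k ≫ c j = k' ≫ c j) : k = k' :=
    (hB j (k' ≫ b j) (k' ≫ c j) (by
      rw [Category.assoc]; exact hF _ _ _ (hbc j))).unique ⟨h₁, h₂⟩ ⟨rfl, rfl⟩
  have hex (i j : ι) {S : A} (x : S ⟶ B i) (t : S ⟶ U j) (h : x ≫ b i ≫ f i = t ≫ f j) :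
      ∃ k : S ⟶ B j, k ≫ b j = t ∧ k ≫ c j = x ≫ c i :=
    (hB j t (x ≫ c i) (by rw [← h]; exact hF _ _ _ (hbc i))).exists
  choose tr tr_b tr_c using @hex
  let E : DescentDatum f :=
    { obj := B
      hom := b
      trans := fun i j S x t h => tr i j x t h
      trans_hom := fun i j S x t h => tr_b i j x t h
      comp_trans := fun i j S S' k x t h => lift_ext j (by simp [tr_b]) (by simp [tr_c])
      trans_self := fun i S x => lift_ext i (by simp [tr_b]) (by simp [tr_c])
      trans_trans := fun i j k S x t t' h h' => lift_ext k (by simp [tr_b]) (by simp [tr_c]) }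
  have inst : ∀ (B : Over X) (i : ι), HasPullback B.hom (f i) := fun B i =>
    haveI := (T.hasPullbacks_of_mem B.hom hf).hasPullback (Presieve.ofArrows.mk i)
    hasPullback_symmetry (f i) B.hom
  have : (descentFunctor f).IsEquivalence := hdesc U f hf
  let D := (descentFunctor f).objPreimage E
  let e : (descentFunctor f).obj D ≅ E := (descentFunctor f).objObjPreimageIso E
  let P (i : ι) : A := pullback D.hom (f i)
  let p (i : ι) : P i ⟶ D.left := pullback.fst _ _
  let q (i : ι) : P i ⟶ U i := pullback.snd _ _
  have hpq (i : ι) : IsPullback (p i) (q i) D.hom (f i) := IsPullback.of_hasPullback _ _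
  let m (i : ι) : P i ⟶ B i := DescentDatum.Hom.app e.hom i
  let n (i : ι) : B i ⟶ P i := DescentDatum.Hom.app e.inv i
  have hmn (i : ι) : m i ≫ n i = 𝟙 _ :=
    congrFun (congrArg DescentDatum.Hom.app e.hom_inv_id) i
  have hnm (i : ι) : n i ≫ m i = 𝟙 _ :=
    congrFun (congrArg DescentDatum.Hom.app e.inv_hom_id) i
  have hmb (i : ι) : m i ≫ b i = q i := DescentDatum.Hom.app_hom e.hom i
  have hnq (i : ι) : n i ≫ q i = b i := DescentDatum.Hom.app_hom e.inv i
  -- Arrows into the pieces `P i` agree in `D` as soon as their components in `Z` agree.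
  have key (i j : ι) {S : A} (x : S ⟶ P i) (y : S ⟶ P j)
      (h : x ≫ q i ≫ f i = y ≫ q j ≫ f j) :
      x ≫ p i = y ≫ p j ↔ x ≫ m i ≫ c i = y ≫ m j ≫ c j := by
    have h' : x ≫ q i ≫ f i = (y ≫ q j) ≫ f j := by rw [h, Category.assoc]
    have hw : (x ≫ p i) ≫ D.hom = (y ≫ q j) ≫ f j := by
      rw [← h', Category.assoc, (hpq i).w]
    let w : S ⟶ P j := pullback.lift (x ≫ p i) (y ≫ q j) hw
    have hwp : w ≫ p j = x ≫ p i := pullback.lift_fst _ _ _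
    have hwq : w ≫ q j = y ≫ q j := pullback.lift_snd _ _ _
    have ht : w ≫ m j = tr i j (x ≫ m i) (y ≫ q j) (by
        rw [Category.assoc, reassoc_of% (hmb i), h']) :=
      DescentDatum.Hom.trans_app e.hom i j x (y ≫ q j) h'
    have hwc : w ≫ m j ≫ c j = x ≫ m i ≫ c i := by
      rw [← Category.assoc, ht, tr_c, Category.assoc]
    refine ⟨fun hp => ?_, fun hc => ?_⟩
    · have : w = y := (hpq j).hom_ext (by rw [hwp, hp]) hwq
      rw [← hwc, this]
    · have : w ≫ m j = y ≫ m j := lift_ext j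
        (by rw [Category.assoc, Category.assoc, hmb, hwq])
        (by rw [Category.assoc, Category.assoc, hwc, hc])
      have : w = y := by
        simpa [hmn] using congr($this ≫ n j)
      rw [← hwp, this]
  have hP : Presieve.ofArrows P p ∈ T D.left :=
    T.mem_coverings_of_isPullback f hf D.hom p q hpq
  obtain ⟨z, hz⟩ := hsub.exists_glue hP (fun i => m i ≫ c i) (fun i j S x y hxy =>
    (key i j x y (by rw [← (hpq i).w, ← (hpq j).w, reassoc_of% hxy])).1 hxy)
  refine ⟨D.left, D.hom, z, ?_, fun S s t hst => ?_⟩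
  · rw [Category.comp_id]
    refine hloc _ _ _ _ hP fun i => ?_
    rw [hz, (hpq i).w, ← hmb, Category.assoc]
    exact hF _ _ _ (hbc i)
  · rw [Category.comp_id] at hst
    obtain ⟨V, v, w, hvw, hV⟩ := exists_cover_pullback hf s
    have hex (i : ι) : ∃ k : V i ⟶ B i, k ≫ b i = w i ∧ k ≫ c i = v i ≫ t :=
      (hB i _ _ (by rw [← (hvw i).w]; exact hF _ _ _ hst)).exists
    choose k hkb hkc using hex
    obtain ⟨l, hl⟩ := hsub.exists_glue hV (fun i => k i ≫ n i ≫ p i) (fun i j S x y hxy => by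
      have := (key i j (x ≫ k i ≫ n i) (y ≫ k j ≫ n j) (by
        simp only [Category.assoc, reassoc_of% (hnq _), reassoc_of% (hkb _), ← (hvw _).w,
          reassoc_of% hxy])).2 (by
        simp only [Category.assoc, reassoc_of% (hnm _), hkc, reassoc_of% hxy])
      simpa only [Category.assoc] using this)
    refine ⟨l, ⟨hsub.hom_ext hV fun i => ?_, hsub.hom_ext hV fun i => ?_⟩, fun l' hl' => ?_⟩
    · rw [reassoc_of% (hl i), (hpq i).w, reassoc_of% (hnq i), reassoc_of% (hkb i), (hvw i).w]
    · rw [reassoc_of% (hl i), hz, reassoc_of% (hnm i), hkc]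
    · refine hsub.hom_ext hV fun i => ?_
      have hw : (v i ≫ l') ≫ D.hom = w i ≫ f i := by rw [Category.assoc, hl'.1, (hvw i).w]
      have h₁ : (hpq i).lift (v i ≫ l') (w i) hw ≫ m i = k i := lift_ext i
        (by rw [Category.assoc, hmb, (hpq i).lift_snd, hkb])
        (by rw [Category.assoc, ← hz, (hpq i).lift_fst_assoc, Category.assoc, hl'.2, hkc])
      rw [hl, ← h₁, Category.assoc, reassoc_of% (hmn i), (hpq i).lift_fst]

/-- A locally liftable arrow is an admissible epimorphism as soon as its base changes along all
arrows that factor through the members of one cover exist. -/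
lemma AdmissibleEpi.of_locally [T.HasPullbacks] [T.IsStableUnderBaseChange]
    (hsub : IsSubcanonical T) (hdesc : EffectiveDescent T) {S X : A} {f : S ⟶ X}
    {ι : Type (max u v)} {U : ι → A} {w : ∀ i, U i ⟶ X} (hw : Presieve.ofArrows U w ∈ T X)
    (hl : ∀ i, ∃ l : U i ⟶ S, l ≫ f = w i)
    (hp : ∀ (i : ι) ⦃V : A⦄ (g : V ⟶ U i), HasPullback f (g ≫ w i)) : AdmissibleEpi T f := by
  have hlift : LocallyLiftable T f := ⟨_, hw, by rintro _ _ ⟨i⟩; exact hl i⟩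
  refine ⟨fun Y g => ?_, fun P Y p q g h => ?_⟩
  · obtain ⟨V, a, b, hab, hV⟩ := exists_cover_pullback hw g
    obtain ⟨B, b, c, hbc, hB⟩ := hdesc.representedOver hsub
      (F := fun _ (s : _ ⟶ Y) (z : _ ⟶ S) => s ≫ g = z ≫ f)
      (fun S S' k s z h => by rw [Category.assoc, h, Category.assoc])
      (fun S s z ι V p hp h => hsub.hom_ext hp fun i => by simpa using h i) hV (fun i => by
        have := hp i (b i)
        have hpb := IsPullback.of_hasPullback f (b i ≫ w i)
        refine ⟨_, pullback.snd f (b i ≫ w i), pullback.fst _ _, ?_, fun S s z h => ?_⟩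
        · exact (by rw [Category.assoc, (hab i).w, hpb.w] :
            (pullback.snd f (b i ≫ w i) ≫ a i) ≫ g = pullback.fst f (b i ≫ w i) ≫ f)
        · have h' : z ≫ f = s ≫ b i ≫ w i := by rw [← (hab i).w, ← h, Category.assoc]
          exact ⟨hpb.lift z s h', ⟨hpb.lift_snd _ _ _, hpb.lift_fst _ _ _⟩, fun k hk =>
            hpb.hom_ext (by rw [hk.2, hpb.lift_fst]) (by rw [hk.1, hpb.lift_snd])⟩)
    rw [Category.comp_id] at hbc
    refine IsPullback.hasPullback (fst := c) (snd := b)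
      (isPullback_of_existsUnique hbc.symm fun Q z s h => ?_)
    simpa only [and_comm] using hB s z (by rw [Category.comp_id]; exact h.symm)
  · have := hlift.of_isPullback h
    exact ⟨hsub.epi this, this⟩

end Site

namespace InternalGroupoid

/-! ### Commutative squares of generalized arrows -/

section Squares

variable {G G' : InternalGroupoid T} {S S' : A}

@[simp] lemma inv_src : G.inv ≫ G.src = G.tgt := G.isGroupoid.inv_src

@[simp] lemma inv_tgt : G.inv ≫ G.tgt = G.src := G.isGroupoid.inv_tgt

@[simp] lemma unit_src : G.unit ≫ G.src = 𝟙 G.obj := G.isGroupoid.unit_src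

@[simp] lemma unit_tgt : G.unit ≫ G.tgt = 𝟙 G.obj := G.isGroupoid.unit_tgt

lemma mul_left_cancel {γ η η' : S ⟶ G.arr} (h : γ ≫ G.src = η ≫ G.tgt)
    (h' : γ ≫ G.src = η' ≫ G.tgt) (e : G.mul γ η h = G.mul γ η' h') : η = η' := by
  rw [← G.inv_mul_cancel_left γ η h (by simp), ← G.inv_mul_cancel_left γ η' h' (by simp)]
  simp only [e]

lemma mul_right_cancel {γ γ' η : S ⟶ G.arr} (h : γ ≫ G.src = η ≫ G.tgt)
    (h' : γ' ≫ G.src = η ≫ G.tgt) (e : G.mul γ η h = G.mul γ' η h') : γ = γ' := by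
  have h₁ := G.mul_assoc γ η (η ≫ G.inv) h (by simp)
  have h₂ := G.mul_assoc γ' η (η ≫ G.inv) h' (by simp)
  simp only [e, mul_inv, mul_unit] at h₁ h₂
  exact h₁.symm.trans h₂

lemma comp_inv_inv (γ : S ⟶ G.arr) : (γ ≫ G.inv) ≫ G.inv = γ := by
  rw [Category.assoc, G.inv_inv, Category.comp_id]

@[simp] lemma comp_hom_obj {H K L : InternalGroupoid T} (f : H ⟶ K) (g : K ⟶ L) :
    (f ≫ g).obj = f.obj ≫ g.obj := rfl

@[simp] lemma comp_hom_arr {H K L : InternalGroupoid T} (f : H ⟶ K) (g : K ⟶ L) :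
    (f ≫ g).arr = f.arr ≫ g.arr := rfl

@[simp] lemma id_hom_obj (H : InternalGroupoid T) : Hom.obj (𝟙 H) = 𝟙 H.obj := rfl

@[simp] lemma id_hom_arr (H : InternalGroupoid T) : Hom.arr (𝟙 H) = 𝟙 H.arr := rfl

/-- Strict arrows preserve products of generalized elements. -/
lemma mul_arr (F : G ⟶ G') (γ η : S ⟶ G.arr) (h : γ ≫ G.src = η ≫ G.tgt) :
    G.mul γ η h ≫ F.arr = G'.mul (γ ≫ F.arr) (η ≫ F.arr) (by
      simp only [Category.assoc, F.arr_src, F.arr_tgt, reassoc_of% h]) := by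
  rw [GroupoidData.mul, Category.assoc, F.m_arr, comp_mul]
  simp

/-- The square with horizontal sides `f : x ⟶ y`, `g : x' ⟶ y'` and vertical sides `a : x ⟶ x'`,
`b : y ⟶ y'` in the groupoid of `S`-valued elements of `G` makes sense and commutes:
`b · f = g · a`. -/
def Comm (G : InternalGroupoid T) {S : A} (f g a b : S ⟶ G.arr) : Prop :=
  ∃ (h : b ≫ G.src = f ≫ G.tgt) (h' : g ≫ G.src = a ≫ G.tgt), G.mul b f h = G.mul g a h'

namespace Comm

variable {f f' g g' k a a' b b' c : S ⟶ G.arr}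

lemma precomp (H : G.Comm f g a b) (l : S' ⟶ S) :
    G.Comm (l ≫ f) (l ≫ g) (l ≫ a) (l ≫ b) := by
  obtain ⟨h, h', e⟩ := H
  exact ⟨by simp only [Category.assoc, h], by simp only [Category.assoc, h'], by
    simpa only [comp_mul] using congr(l ≫ $e)⟩

lemma map (H : G.Comm f g a b) (F : G ⟶ G') :
    G'.Comm (f ≫ F.arr) (g ≫ F.arr) (a ≫ F.arr) (b ≫ F.arr) := by
  obtain ⟨h, h', e⟩ := H
  exact ⟨by simp only [Category.assoc, F.arr_src, F.arr_tgt, reassoc_of% h],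
    by simp only [Category.assoc, F.arr_src, F.arr_tgt, reassoc_of% h'], by
    simpa only [mul_arr] using congr($e ≫ F.arr)⟩

lemma flip (H : G.Comm f g a b) : G.Comm a b f g := by
  obtain ⟨h, h', e⟩ := H
  exact ⟨h', h, e.symm⟩

lemma right_tgt (H : G.Comm f g a b) : b ≫ G.tgt = g ≫ G.tgt := by
  obtain ⟨h, h', e⟩ := H
  simpa using congr($e ≫ G.tgt)

lemma left_src (H : G.Comm f g a b) : f ≫ G.src = a ≫ G.src := by
  obtain ⟨h, h', e⟩ := H
  simpa using congr($e ≫ G.src)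

/-- Horizontal pasting. -/
lemma mul (H : G.Comm f g a b) (H' : G.Comm f' g' b c) (hf : f' ≫ G.src = f ≫ G.tgt)
    (hg : g' ≫ G.src = g ≫ G.tgt) : G.Comm (G.mul f' f hf) (G.mul g' g hg) a c := by
  obtain ⟨h₁, h₂, e⟩ := H
  obtain ⟨h₃, h₄, e'⟩ := H'
  refine ⟨by rw [mul_tgt, h₃], by rw [mul_src, h₂], ?_⟩
  rw [G.isGroupoid.mul_assoc g' g a hg h₂, ← G.isGroupoid.mul_assoc c f' f h₃ hf]
  simp only [← e, e']
  exact G.isGroupoid.mul_assoc g' b f h₄ h₁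

/-- Vertical pasting. -/
lemma mul_vert (H : G.Comm f g a b) (H' : G.Comm g k a' b') (ha : a' ≫ G.src = a ≫ G.tgt)
    (hb : b' ≫ G.src = b ≫ G.tgt) : G.Comm f k (G.mul a' a ha) (G.mul b' b hb) :=
  (H.flip.mul H'.flip ha hb).flip

lemma inv (H : G.Comm f g a b) : G.Comm g f (a ≫ G.inv) (b ≫ G.inv) := by
  obtain ⟨h₁, h₂, e⟩ := id H
  have hs := H.left_src
  have ht := H.right_tgt
  have h₃ : (b ≫ G.inv) ≫ G.src = g ≫ G.tgt := by rw [comp_inv_src, ht]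
  refine ⟨h₃, by rw [comp_inv_tgt, hs], ?_⟩
  apply mul_right_cancel (η := a) (by rw [mul_src, h₂]) (by rw [mul_src, comp_inv_src])
  rw [G.isGroupoid.mul_assoc _ g a h₃ h₂,
    G.isGroupoid.mul_assoc f _ a (by rw [comp_inv_tgt, hs]) (by rw [comp_inv_src])]
  simp only [← e, inv_mul, mul_unit]
  exact G.inv_mul_cancel_left b f h₁ (by rw [mul_tgt, comp_inv_src])

lemma one (f : S ⟶ G.arr) : G.Comm f f ((f ≫ G.src) ≫ G.unit) ((f ≫ G.tgt) ≫ G.unit) := by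
  refine ⟨by simp, by simp, ?_⟩
  rw [unit_mul, mul_unit]

lemma eq_top (H : G.Comm f g a b) (H' : G.Comm f' g a b) : f = f' := by
  obtain ⟨h₁, h₂, e⟩ := H
  obtain ⟨h₃, h₄, e'⟩ := H'
  exact mul_left_cancel h₁ h₃ (e.trans e'.symm)

lemma eq_bot (H : G.Comm f g a b) (H' : G.Comm f g' a b) : g = g' := by
  obtain ⟨h₁, h₂, e⟩ := H
  obtain ⟨h₃, h₄, e'⟩ := H'
  exact mul_right_cancel h₂ h₄ (e.symm.trans e')

lemma exists_top (g a b : S ⟶ G.arr) (h : g ≫ G.src = a ≫ G.tgt) (h' : b ≫ G.tgt = g ≫ G.tgt) :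
    ∃ f, f ≫ G.src = a ≫ G.src ∧ f ≫ G.tgt = b ≫ G.src ∧ G.Comm f g a b := by
  have h₁ : (b ≫ G.inv) ≫ G.src = G.mul g a h ≫ G.tgt := by rw [comp_inv_src, mul_tgt, h']
  have H : G.Comm (G.mul (b ≫ G.inv) (G.mul g a h) h₁) g a b := by
    refine ⟨by simp, h, ?_⟩
    have := G.inv_mul_cancel_left (b ≫ G.inv) (G.mul g a h) h₁ (by simp)
    simpa only [comp_inv_inv] using this
  exact ⟨_, by simp, by simp, H⟩

lemma exists_bot (f a b : S ⟶ G.arr) (h : f ≫ G.src = a ≫ G.src) (h' : b ≫ G.src = f ≫ G.tgt) :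
    ∃ g, g ≫ G.src = a ≫ G.tgt ∧ g ≫ G.tgt = b ≫ G.tgt ∧ G.Comm f g a b := by
  obtain ⟨g, h₁, h₂, H⟩ := exists_top f (a ≫ G.inv) (b ≫ G.inv) (by simp [h]) (by simp [h'])
  refine ⟨g, by simpa using h₁, by simpa using h₂, ?_⟩
  simpa only [comp_inv_inv] using H.inv

end Comm

/-- A multiplicative map of arrows is a strict arrow: it preserves inverses automatically. -/
def Hom.ofMul {H G : InternalGroupoid T} (obj : H.obj ⟶ G.obj) (arr : H.arr ⟶ G.arr)
    (arr_src : arr ≫ G.src = H.src ≫ obj) (arr_tgt : arr ≫ G.tgt = H.tgt ≫ obj)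
    (m_arr : H.m ≫ arr = G.mul (H.fst ≫ arr) (H.snd ≫ arr)
      (by simp only [Category.assoc, arr_src, arr_tgt, reassoc_of% H.isPullback.w])) : H ⟶ G where
  obj := obj
  arr := arr
  arr_src := arr_src
  arr_tgt := arr_tgt
  m_arr := m_arr
  inv_arr := by
    have hmul {S : A} (γ η : S ⟶ H.arr) (h : γ ≫ H.src = η ≫ H.tgt) :
        H.mul γ η h ≫ arr = G.mul (γ ≫ arr) (η ≫ arr) (by
          simp only [Category.assoc, arr_src, arr_tgt, reassoc_of% h]) := by
      rw [GroupoidData.mul, Category.assoc, m_arr, comp_mul]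
      simp
    -- Units are the idempotents, so they are preserved by multiplicative maps.
    have hunit : H.unit ≫ arr = obj ≫ G.unit := by
      have e := hmul H.unit H.unit (by rw [H.isGroupoid.unit_src, H.isGroupoid.unit_tgt])
      have e' := H.unit_mul (𝟙 _) H.unit (by simp [H.isGroupoid.unit_src, H.isGroupoid.unit_tgt])
      simp only [Category.id_comp] at e'
      rw [e'] at e
      refine mul_left_cancel (γ := H.unit ≫ arr) ?_ ?_ (e.symm.trans (G.mul_unit _ _ ?_).symm)
      all_goals simp [arr_src, arr_tgt, reassoc_of% H.isGroupoid.unit_src,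
        reassoc_of% H.isGroupoid.unit_tgt, G.isGroupoid.unit_tgt]
    refine G.eq_inv_of_mul arr (H.inv ≫ arr) ?_ ?_
    · rw [Category.assoc, arr_src, arr_tgt, reassoc_of% H.isGroupoid.inv_tgt]
    · have := hmul (𝟙 _) H.inv (by simp [H.isGroupoid.inv_tgt])
      simp only [Category.id_comp, H.isGroupoid.mul_inv] at this
      rw [← this, Category.assoc, hunit, arr_tgt, Category.assoc]

end Squares

/-! ### Strong homotopies are natural isomorphisms -/

section Natural

variable {H K G L : InternalGroupoid T}

/-- `t` assigns to the objects `x` of `H` arrows `φ x ⟶ ψ x` of `G`, naturally in `x`. -/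
structure IsNatTrans (t : H.obj ⟶ G.arr) (φ ψ : H ⟶ G) : Prop where
  src : t ≫ G.src = φ.obj
  tgt : t ≫ G.tgt = ψ.obj
  comm : G.Comm φ.arr ψ.arr (H.src ≫ t) (H.tgt ≫ t)

/-- The natural isomorphy of strict arrows. -/
def NatIso (φ ψ : H ⟶ G) : Prop := ∃ t, IsNatTrans t φ ψ

namespace NatIso

variable {φ ψ χ : H ⟶ G}

lemma refl (φ : H ⟶ G) : NatIso φ φ := by
  refine ⟨φ.obj ≫ G.unit, by simp, by simp, ?_⟩
  have := Comm.one φ.arr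
  simpa only [φ.arr_src, φ.arr_tgt, Category.assoc] using this

lemma symm : NatIso φ ψ → NatIso ψ φ := by
  rintro ⟨t, h⟩
  refine ⟨t ≫ G.inv, by simp [h.tgt], by simp [h.src], ?_⟩
  simpa only [Category.assoc] using h.comm.inv

lemma trans : NatIso φ ψ → NatIso ψ χ → NatIso φ χ := by
  rintro ⟨t, h⟩ ⟨t', h'⟩
  refine ⟨G.mul t' t (h'.src.trans h.tgt.symm), by simp [h.src], by simp [h'.tgt], ?_⟩
  simp only [comp_mul]
  exact h.comm.mul_vert h'.comm _ _

lemma whisker_left (k : K ⟶ H) : NatIso φ ψ → NatIso (k ≫ φ) (k ≫ ψ) := by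
  rintro ⟨t, h⟩
  refine ⟨k.obj ≫ t, by simp [h.src], by simp [h.tgt], ?_⟩
  simpa only [comp_hom_arr, ← Category.assoc, k.arr_src, k.arr_tgt] using h.comm.precomp k.arr

lemma whisker_right (k : G ⟶ L) : NatIso φ ψ → NatIso (φ ≫ k) (ψ ≫ k) := by
  rintro ⟨t, h⟩
  refine ⟨t ≫ k.arr, by simp [k.arr_src, reassoc_of% h.src], by
    simp [k.arr_tgt, reassoc_of% h.tgt], ?_⟩
  simpa only [comp_hom_arr, ← Category.assoc] using h.comm.map k

end NatIso

variable [T.HasIsos] [T.IsStableUnderComposition] {φ ψ : H ⟶ G}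

/-- An arrow into the cocylinder is a natural transformation between its end points. -/
lemma isNatTrans_path (h : H ⟶ G.path) : IsNatTrans h.obj (h ≫ G.e₀) (h ≫ G.e₁) where
  src := rfl
  tgt := rfl
  comm := by
    have key (a : H.arr ⟶ G.Sq) (t : H.obj ⟶ G.arr) (hs : a ≫ G.sqσ = H.src ≫ t)
        (ht : a ≫ G.sqτ = H.tgt ≫ t) :
        G.Comm (a ≫ G.sqA) (a ≫ G.sqB) (H.src ≫ t) (H.tgt ≫ t) := by
      have hw : (a ≫ G.sqτ) ≫ G.src = (a ≫ G.sqA) ≫ G.tgt := by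
        rw [Category.assoc, sqτ_src, Category.assoc]
      rw [← hs, ← ht]
      exact ⟨hw, by simp only [Category.assoc, sqB_src], G.sqτ_mul a hw⟩
    exact key h.arr h.obj h.arr_src h.arr_tgt

lemma rightHomotopic_iff : RightHomotopic φ ψ ↔ NatIso φ ψ := by
  constructor
  · rintro ⟨h, rfl, rfl⟩
    exact ⟨_, isNatTrans_path h⟩
  · rintro ⟨t, h⟩
    have ha : φ.arr ≫ G.src = (H.src ≫ t) ≫ G.src := by rw [φ.arr_src, Category.assoc, h.src]
    have hb : ψ.arr ≫ G.src = (H.src ≫ t) ≫ G.tgt := by rw [ψ.arr_src, Category.assoc, h.tgt]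
    have hτ : sqLift φ.arr (H.src ≫ t) ψ.arr ha hb ≫ G.sqτ = H.tgt ≫ t := by
      obtain ⟨h₁, h₂, e⟩ := h.comm
      apply comp_sqτ_eq
      · simpa only [sqLift_sqA, sqLift_sqB, sqLift_sqσ] using e
      · simpa only [sqLift_sqA] using h₁
    have hc : (H.fst ≫ sqLift φ.arr (H.src ≫ t) ψ.arr ha hb) ≫ G.sqσ =
        (H.snd ≫ sqLift φ.arr (H.src ≫ t) ψ.arr ha hb) ≫ G.sqτ := by
      rw [Category.assoc, Category.assoc, hτ, sqLift_sqσ, reassoc_of% H.isPullback.w]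
    have hm : H.m ≫ sqLift φ.arr (H.src ≫ t) ψ.arr ha hb = sqMul _ _ hc := by
      apply sq_hom_ext
      · simp only [sqMul, Category.assoc, sqLift_sqA, φ.m_arr]
      · simp only [sqMul, Category.assoc, sqLift_sqσ, reassoc_of% H.isGroupoid.m_src]
      · simp only [sqMul, Category.assoc, sqLift_sqB, ψ.m_arr]
    exact ⟨Hom.ofMul (G := G.path) t (sqLift φ.arr (H.src ≫ t) ψ.arr ha hb)
      (sqLift_sqσ _ _ _ _ _) hτ (hm.trans (pathData_mul _ _ hc).symm),
      Hom.ext h.src (sqLift_sqA _ _ _ ha hb), Hom.ext h.tgt (sqLift_sqB _ _ _ ha hb)⟩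

/-- Natural isomorphisms compose, so a chain of homotopies reduces to a single one. -/
lemma stronglyHomotopic_iff : StronglyHomotopic φ ψ ↔ NatIso φ ψ := by
  constructor
  · rintro ⟨n, hn⟩
    induction n generalizing ψ with
    | zero => obtain rfl : φ = ψ := hn; exact NatIso.refl _
    | succ n ih =>
      obtain ⟨χ, h, h'⟩ := hn
      exact (ih h).trans (rightHomotopic_iff.1 h')
  · intro h
    exact ⟨1, φ, rfl, rightHomotopic_iff.2 h⟩

end Natural

/-! ### Essential equivalences -/

section Essential

variable {H K G : InternalGroupoid T}

lemma exists_mul_eq {S : A} (γ b : S ⟶ G.arr) (h : γ ≫ G.tgt = b ≫ G.tgt) :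
    ∃ f, f ≫ G.src = γ ≫ G.src ∧ f ≫ G.tgt = b ≫ G.src ∧ ∃ h, G.mul b f h = γ := by
  obtain ⟨f, h₁, h₂, h₃, h₄, e⟩ :=
    Comm.exists_top ((γ ≫ G.tgt) ≫ G.unit) γ b (by simp) (by simp [h])
  exact ⟨f, h₁, h₂, h₃, by rw [e, unit_mul]⟩

lemma FullyFaithful.hom_ext {ε : H ⟶ G} (hε : FullyFaithful ε) {S : A} {η η' : S ⟶ H.arr}
    (hs : η ≫ H.src = η' ≫ H.src) (ht : η ≫ H.tgt = η' ≫ H.tgt)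
    (h : η ≫ ε.arr = η' ≫ ε.arr) : η = η' :=
  (hε (η' ≫ H.src) (η' ≫ H.tgt) (η' ≫ ε.arr) (by simp [ε.arr_src]) (by simp [ε.arr_tgt])).unique
    ⟨hs, ht, h⟩ ⟨rfl, rfl, rfl⟩

/-- Every generalized object of `G` is, locally on its domain, isomorphic to one in the image
of `ε`. -/
def LocallyEssSurj (ε : H ⟶ G) : Prop :=
  ∀ ⦃S : A⦄ (y : S ⟶ G.obj), ∃ (ι : Type (max u v)) (V : ι → A) (p : ∀ i, V i ⟶ S),
    Presieve.ofArrows V p ∈ T S ∧ ∀ i, ∃ (x : V i ⟶ H.obj) (γ : V i ⟶ G.arr),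
      γ ≫ G.src = x ≫ ε.obj ∧ γ ≫ G.tgt = p i ≫ y

lemma EssentialEquiv.locallyEssSurj {ε : H ⟶ G} (hε : EssentialEquiv ε) : LocallyEssSurj ε := by
  intro S y
  obtain ⟨⟨P, p₁, p₂, hP, ha⟩, -⟩ := hε
  have := ha.1 y
  obtain ⟨-, R, hR, hl⟩ := ha.2 _ _ _ (IsPullback.of_hasPullback _ y)
  obtain ⟨ι, V, p, rfl⟩ := R.exists_eq_ofArrows
  refine ⟨ι, V, p, hR, fun i => ?_⟩
  obtain ⟨l, hl⟩ := hl (p i) ⟨i⟩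
  refine ⟨l ≫ pullback.fst _ _ ≫ p₂, l ≫ pullback.fst _ _ ≫ p₁, ?_, ?_⟩
  · simp only [Category.assoc, hP.w]
  · simp only [Category.assoc, pullback.condition, reassoc_of% hl]

lemma FullyFaithful.comp {ε : H ⟶ K} {δ : K ⟶ G} (hε : FullyFaithful ε) (hδ : FullyFaithful δ) :
    FullyFaithful (ε ≫ δ) := by
  intro S x y γ hs ht
  obtain ⟨κ, ⟨hκs, hκt, hκ⟩, -⟩ := hδ (x ≫ ε.obj) (y ≫ ε.obj) γ (by simpa using hs)
    (by simpa using ht)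
  obtain ⟨η, ⟨hηs, hηt, hη⟩, -⟩ := hε x y κ hκs hκt
  refine ⟨η, ⟨hηs, hηt, by simp [reassoc_of% hη, hκ]⟩, fun η' ⟨h₁, h₂, h₃⟩ => ?_⟩
  refine hε.hom_ext (by rw [h₁, hηs]) (by rw [h₂, hηt])
    (hδ.hom_ext (by simp [ε.arr_src, reassoc_of% h₁, reassoc_of% hηs])
      (by simp [ε.arr_tgt, reassoc_of% h₂, reassoc_of% hηt]) ?_)
  rw [hη, hκ, Category.assoc]
  exact h₃

/-- The conjugate of an arrow between images of `φ` by a natural isomorphism `φ ⟶ ψ`. -/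
lemma IsNatTrans.exists_conj {φ ψ : H ⟶ G} {t : H.obj ⟶ G.arr} (ht : IsNatTrans t φ ψ) {S : A}
    (x y : S ⟶ H.obj) (γ : S ⟶ G.arr) (h : γ ≫ G.src = x ≫ φ.obj) (h' : γ ≫ G.tgt = y ≫ φ.obj) :
    ∃ δ, δ ≫ G.src = x ≫ ψ.obj ∧ δ ≫ G.tgt = y ≫ ψ.obj ∧ G.Comm γ δ (x ≫ t) (y ≫ t) := by
  obtain ⟨δ, h₁, h₂, h₃⟩ := Comm.exists_bot γ (x ≫ t) (y ≫ t) (by simp [ht.src, h])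
    (by simp [ht.src, h'])
  exact ⟨δ, by simpa [ht.tgt] using h₁, by simpa [ht.tgt] using h₂, h₃⟩

lemma IsNatTrans.comm_of {φ ψ : H ⟶ G} {t : H.obj ⟶ G.arr} (ht : IsNatTrans t φ ψ) {S : A}
    {x y : S ⟶ H.obj} {η : S ⟶ H.arr} (h : η ≫ H.src = x) (h' : η ≫ H.tgt = y) :
    G.Comm (η ≫ φ.arr) (η ≫ ψ.arr) (x ≫ t) (y ≫ t) := by
  subst h h'
  simpa only [Category.assoc] using ht.comm.precomp η

lemma FullyFaithful.of_natIso {ε δ : H ⟶ G} (h : NatIso ε δ) (hδ : FullyFaithful δ) :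
    FullyFaithful ε := by
  obtain ⟨t, ht⟩ := h
  intro S x y γ hs ht'
  obtain ⟨γ', h₁, h₂, h₃⟩ := ht.exists_conj x y γ hs ht'
  obtain ⟨η, ⟨hηs, hηt, hη⟩, -⟩ := hδ x y γ' h₁ h₂
  refine ⟨η, ⟨hηs, hηt, ?_⟩, fun η' ⟨e₁, e₂, e₃⟩ => ?_⟩
  · have := ht.comm_of hηs hηt
    rw [hη] at this
    exact this.eq_top h₃
  · refine hδ.hom_ext (by rw [e₁, hηs]) (by rw [e₂, hηt]) ?_
    have := ht.comm_of e₁ e₂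
    rw [e₃] at this
    rw [hη, this.eq_bot h₃]

lemma LocallyEssSurj.of_natIso {ε δ : H ⟶ G} (h : NatIso ε δ) (hδ : LocallyEssSurj δ) :
    LocallyEssSurj ε := by
  obtain ⟨t, ht⟩ := h
  intro S y
  obtain ⟨ι, V, p, hV, hl⟩ := hδ y
  refine ⟨ι, V, p, hV, fun i => ?_⟩
  obtain ⟨x, γ, h₁, h₂⟩ := hl i
  exact ⟨x, G.mul γ (x ≫ t) (by rw [h₁, Category.assoc, ht.tgt]), by simp [ht.src], by simp [h₂]⟩

lemma LocallyEssSurj.comp [T.IsStableUnderComposition] {ε : H ⟶ K} {δ : K ⟶ G}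
    (hε : LocallyEssSurj ε) (hδ : LocallyEssSurj δ) : LocallyEssSurj (ε ≫ δ) := by
  intro S y
  obtain ⟨ι, V, p, hV, hl⟩ := hδ y
  choose x γ hγs hγt using hl
  choose κ W q hW hl using fun i => hε (x i)
  refine ⟨_, _, _, T.comp_mem_coverings p hV q hW, fun ⟨i, j⟩ => ?_⟩
  obtain ⟨z, η, h₁, h₂⟩ := hl i j
  refine ⟨z, G.mul (q i j ≫ γ i) (η ≫ δ.arr) (by
    rw [Category.assoc, hγs, Category.assoc, δ.arr_tgt, reassoc_of% h₂]), ?_, ?_⟩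
  · simp [δ.arr_src, reassoc_of% h₁]
  · simp [hγt]

/-- A strict arrow with an inverse up to natural isomorphism is fully faithful. -/
lemma FullyFaithful.of_inverse {h : H ⟶ G} {k : G ⟶ H} (h₁ : NatIso (h ≫ k) (𝟙 H))
    (h₂ : NatIso (k ≫ h) (𝟙 G)) : FullyFaithful h := by
  obtain ⟨t, ht⟩ := h₁
  obtain ⟨t', ht'⟩ := h₂
  -- The inverse `k` is faithful; applied to `h η` and a given arrow, this makes `h` full.
  have faithful {S : A} {γ γ' : S ⟶ G.arr} (hs : γ ≫ G.src = γ' ≫ G.src)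
      (hr : γ ≫ G.tgt = γ' ≫ G.tgt) (e : γ ≫ k.arr = γ' ≫ k.arr) : γ = γ' := by
    have e₁ := ht'.comm_of (η := γ) rfl rfl
    have e₂ := ht'.comm_of (η := γ') rfl rfl
    simp only [comp_hom_arr, id_hom_arr, Category.comp_id, ← Category.assoc γ, hs, hr, e] at e₁
    simp only [comp_hom_arr, id_hom_arr, Category.comp_id, ← Category.assoc γ'] at e₂
    exact e₁.eq_bot e₂
  intro S x y γ hs hr
  have hks : (γ ≫ k.arr) ≫ H.src = x ≫ (h ≫ k).obj := by simp [k.arr_src, reassoc_of% hs]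
  have hkr : (γ ≫ k.arr) ≫ H.tgt = y ≫ (h ≫ k).obj := by simp [k.arr_tgt, reassoc_of% hr]
  obtain ⟨η, e₁, e₂, e₃⟩ := ht.exists_conj x y _ hks hkr
  simp only [id_hom_obj, Category.comp_id] at e₁ e₂
  refine ⟨η, ⟨e₁, e₂, ?_⟩, fun η' ⟨e₁', e₂', e₃'⟩ => ?_⟩
  · refine faithful (by simp [h.arr_src, reassoc_of% e₁, hs])
      (by simp [h.arr_tgt, reassoc_of% e₂, hr]) ?_
    have := (ht.comm_of e₁ e₂)
    simp only [id_hom_arr, Category.comp_id] at this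
    simpa using this.eq_top e₃
  · have := ht.comm_of e₁' e₂'
    simp only [comp_hom_arr, reassoc_of% e₃', id_hom_arr, Category.comp_id] at this
    exact this.eq_bot e₃

lemma LocallyEssSurj.of_rightInverse [T.HasIsos] {h : H ⟶ G} {k : G ⟶ H}
    (h₂ : NatIso (k ≫ h) (𝟙 G)) : LocallyEssSurj h := by
  obtain ⟨t, ht⟩ := h₂
  intro S y
  refine ⟨PUnit, fun _ => S, fun _ => 𝟙 S, ?_, fun _ => ⟨y ≫ k.obj, y ≫ t, ?_, ?_⟩⟩
  · rw [Presieve.ofArrows_pUnit]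
    exact T.mem_coverings_of_isIso _
  · simp [ht.src]
  · simp [ht.tgt]

variable [T.HasIsos] [T.HasPullbacks] [T.IsStableUnderBaseChange] [T.IsStableUnderComposition]

/-- A fully faithful strict arrow that is locally essentially surjective is an essential
equivalence. Over a piece `V` of the base on which the objects of `G` are isomorphic to images of
objects `x` of `H`, the arrows of `G` from images of `H` to `V` correspond to the arrows of `H`
with range `x`; so the pullbacks required of an admissible epimorphism exist over `V`. -/
lemma EssentialEquiv.of_locallyEssSurj (hsub : IsSubcanonical T) (hdesc : EffectiveDescent T)
    {ε : H ⟶ G} (hff : FullyFaithful ε) (hes : LocallyEssSurj ε) : EssentialEquiv ε := by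
  refine ⟨?_, hff⟩
  have := G.src_admissible.1 ε.obj
  have hP := IsPullback.of_hasPullback G.src ε.obj
  obtain ⟨ι, U, w, hw, hl⟩ := hes (𝟙 _)
  choose x γ hγs hγt using hl
  simp only [Category.comp_id] at hγt
  refine ⟨_, _, _, hP, AdmissibleEpi.of_locally hsub hdesc hw
    (fun i => ⟨hP.lift (γ i) (x i) (hγs i), by rw [hP.lift_fst_assoc, hγt]⟩) fun i V g => ?_⟩
  have := H.tgt_admissible.1 (g ≫ x i)
  have hQ := IsPullback.of_hasPullback H.tgt (g ≫ x i)
  set Q := pullback H.tgt (g ≫ x i)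
  let η : Q ⟶ H.arr := pullback.fst _ _
  let b : Q ⟶ V := pullback.snd _ _
  have hb : (b ≫ g ≫ γ i) ≫ G.src = (η ≫ ε.arr) ≫ G.tgt := by
    have : η ≫ H.tgt = b ≫ g ≫ x i := hQ.w
    simp only [Category.assoc, hγs, ε.arr_tgt, reassoc_of% this]
  let a := hP.lift (G.mul (b ≫ g ≫ γ i) (η ≫ ε.arr) hb) (η ≫ H.src) (by simp [ε.arr_src])
  have ha₁ : a ≫ pullback.fst _ _ = G.mul (b ≫ g ≫ γ i) (η ≫ ε.arr) hb := hP.lift_fst _ _ _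
  have ha₂ : a ≫ pullback.snd _ _ = η ≫ H.src := hP.lift_snd _ _ _
  refine IsPullback.hasPullback (fst := a) (snd := b)
    (isPullback_of_existsUnique ?_ fun S c d hcd => ?_)
  · rw [reassoc_of% ha₁, mul_tgt]
    simp [hγt]
  · obtain ⟨f, hf₁, hf₂, hf₃, e⟩ := exists_mul_eq (c ≫ pullback.fst G.src ε.obj) (d ≫ g ≫ γ i)
      (by simp only [Category.assoc, hcd, hγt])
    obtain ⟨ζ, ⟨hζ₁, hζ₂, hζ₃⟩, -⟩ := hff (c ≫ pullback.snd _ _) (d ≫ g ≫ x i) f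
      (by simp only [hf₁, Category.assoc, hP.w]) (by simp only [hf₂, Category.assoc, hγs])
    have hk₁ : hQ.lift ζ d hζ₂ ≫ η = ζ := hQ.lift_fst _ _ _
    have hk₂ : hQ.lift ζ d hζ₂ ≫ b = d := hQ.lift_snd _ _ _
    refine ⟨hQ.lift ζ d hζ₂, ⟨hP.hom_ext ?_ ?_, hk₂⟩, fun k ⟨h₁, h₂⟩ => ?_⟩
    · rw [Category.assoc, ha₁, comp_mul, ← e]
      simp only [reassoc_of% hk₁, reassoc_of% hk₂, hζ₃]
    · rw [Category.assoc, ha₂, reassoc_of% hk₁, hζ₁]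
    · refine hQ.hom_ext ?_ (h₂.trans hk₂.symm)
      refine Eq.trans ?_ hk₁.symm
      change k ≫ η = ζ
      have hk : (k ≫ η) ≫ H.tgt = d ≫ g ≫ x i := by
        rw [Category.assoc, show η ≫ H.tgt = b ≫ g ≫ x i from hQ.w, reassoc_of% h₂]
      refine hff.hom_ext ?_ (hk.trans hζ₂.symm) ?_
      · rw [hζ₁, ← h₁, Category.assoc, Category.assoc, ha₂]
      · rw [hζ₃]
        refine mul_left_cancel (γ := d ≫ g ≫ γ i) ?_ hf₃ ?_
        · simp only [Category.assoc, hγs, ε.arr_tgt]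
          simp only [← Category.assoc] at hk ⊢
          rw [hk]
        · rw [e, ← h₁]
          simp only [Category.assoc, ha₁, comp_mul, reassoc_of% h₂]

lemma EssentialEquiv.comp (hsub : IsSubcanonical T) (hdesc : EffectiveDescent T)
    {ε : H ⟶ K} {δ : K ⟶ G} (hε : EssentialEquiv ε) (hδ : EssentialEquiv δ) :
    EssentialEquiv (ε ≫ δ) :=
  .of_locallyEssSurj hsub hdesc (hε.2.comp hδ.2) (hε.locallyEssSurj.comp hδ.locallyEssSurj)

lemma EssentialEquiv.of_inverse (hsub : IsSubcanonical T) (hdesc : EffectiveDescent T)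
    {h : H ⟶ G} {k : G ⟶ H} (h₁ : NatIso (h ≫ k) (𝟙 H)) (h₂ : NatIso (k ≫ h) (𝟙 G)) :
    EssentialEquiv h :=
  .of_locallyEssSurj hsub hdesc (.of_inverse h₁ h₂) (.of_rightInverse h₂)

lemma EssentialEquiv.id (hsub : IsSubcanonical T) (hdesc : EffectiveDescent T) :
    EssentialEquiv (𝟙 G) :=
  .of_inverse hsub hdesc (k := 𝟙 G) (by simpa using NatIso.refl _) (by simpa using NatIso.refl _)

/-- The class `W` consists of the essential equivalences. -/
lemma essentialHomotopyEquiv_iff (hsub : IsSubcanonical T) (hdesc : EffectiveDescent T)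
    {η : H ⟶ G} : EssentialHomotopyEquiv η ↔ EssentialEquiv η := by
  constructor
  · rintro ⟨L, h, ε, ⟨k, h₁, h₂⟩, hε, hη⟩
    rw [stronglyHomotopic_iff] at h₁ h₂ hη
    have hc := (EssentialEquiv.of_inverse hsub hdesc h₁ h₂).comp hsub hdesc hε
    exact .of_locallyEssSurj hsub hdesc (.of_natIso hη hc.2) (.of_natIso hη hc.locallyEssSurj)
  · intro hη
    have hid : StronglyHomotopic (𝟙 H ≫ 𝟙 H) (𝟙 H) :=
      stronglyHomotopic_iff.2 (by simpa using NatIso.refl _)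
    exact ⟨H, 𝟙 H, η, ⟨𝟙 H, hid, hid⟩, hη,
      stronglyHomotopic_iff.2 (by simpa using NatIso.refl _)⟩

end Essential

/-! ### Groupoids induced along an arrow into the objects -/

/-- The arrows of a groupoid with objects `P` induced from `G` along `q : P ⟶ G₀`: `arr` is the
pullback of `(s, r) : G₁ ⟶ G₀ × G₀` along `q × q`, stated without using products, and its range
map is required to be an admissible epimorphism. -/
structure ArrowPullback (G : InternalGroupoid T) {P : A} (q : P ⟶ G.obj) where
  arr : A
  src : arr ⟶ P
  tgt : arr ⟶ P
  map : arr ⟶ G.arr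
  map_src : map ≫ G.src = src ≫ q
  map_tgt : map ≫ G.tgt = tgt ≫ q
  univ : ∀ ⦃S : A⦄ (x y : S ⟶ P) (γ : S ⟶ G.arr), γ ≫ G.src = x ≫ q → γ ≫ G.tgt = y ≫ q →
    ∃! η : S ⟶ arr, η ≫ src = x ∧ η ≫ tgt = y ∧ η ≫ map = γ
  tgt_admissible : AdmissibleEpi T tgt

namespace ArrowPullback

variable {G : InternalGroupoid T} {P : A} {q : P ⟶ G.obj} (I : ArrowPullback G q)

section Lift

variable {S : A}

lemma hom_ext {η η' : S ⟶ I.arr} (hs : η ≫ I.src = η' ≫ I.src) (ht : η ≫ I.tgt = η' ≫ I.tgt)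
    (h : η ≫ I.map = η' ≫ I.map) : η = η' :=
  (I.univ (η' ≫ I.src) (η' ≫ I.tgt) (η' ≫ I.map) (by simp [I.map_src])
    (by simp [I.map_tgt])).unique ⟨hs, ht, h⟩ ⟨rfl, rfl, rfl⟩

variable (x y : S ⟶ P) (γ : S ⟶ G.arr) (h : γ ≫ G.src = x ≫ q) (h' : γ ≫ G.tgt = y ≫ q)

/-- The arrow `x ⟶ y` of the induced groupoid given by an arrow `q x ⟶ q y` of `G`. -/
noncomputable def lift : S ⟶ I.arr := (I.univ x y γ h h').choose

@[simp] lemma lift_src : I.lift x y γ h h' ≫ I.src = x := (I.univ x y γ h h').choose_spec.1.1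

@[simp] lemma lift_tgt : I.lift x y γ h h' ≫ I.tgt = y := (I.univ x y γ h h').choose_spec.1.2.1

@[simp] lemma lift_map : I.lift x y γ h h' ≫ I.map = γ := (I.univ x y γ h h').choose_spec.1.2.2

end Lift

instance : HasPullback I.src I.tgt :=
  have := I.tgt_admissible.1 I.src
  hasPullback_symmetry _ _

/-- The units of the induced groupoid. -/
noncomputable def one : P ⟶ I.arr := I.lift (𝟙 P) (𝟙 P) (q ≫ G.unit) (by simp) (by simp)

/-- The inversion of the induced groupoid. -/
noncomputable def inv : I.arr ⟶ I.arr :=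
  I.lift I.tgt I.src (I.map ≫ G.inv) (by simp [I.map_tgt]) (by simp [I.map_src])

section Mul

variable {S : A}

lemma map_composable {γ η : S ⟶ I.arr} (h : γ ≫ I.src = η ≫ I.tgt) :
    (γ ≫ I.map) ≫ G.src = (η ≫ I.map) ≫ G.tgt := by
  simp only [Category.assoc, I.map_src, I.map_tgt, reassoc_of% h]

variable (γ η : S ⟶ I.arr) (h : γ ≫ I.src = η ≫ I.tgt)

/-- The product of the induced groupoid. -/
noncomputable def mul : S ⟶ I.arr :=
  I.lift (η ≫ I.src) (γ ≫ I.tgt) (G.mul (γ ≫ I.map) (η ≫ I.map) (I.map_composable h))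
    (by simp [I.map_src]) (by simp [I.map_tgt])

@[simp] lemma mul_src : I.mul γ η h ≫ I.src = η ≫ I.src := I.lift_src _ _ _ _ _

@[simp] lemma mul_tgt : I.mul γ η h ≫ I.tgt = γ ≫ I.tgt := I.lift_tgt _ _ _ _ _

@[simp] lemma mul_map : I.mul γ η h ≫ I.map =
    G.mul (γ ≫ I.map) (η ≫ I.map) (I.map_composable h) := I.lift_map _ _ _ _ _

lemma comp_mul {S' : A} (k : S' ⟶ S) :
    k ≫ I.mul γ η h = I.mul (k ≫ γ) (k ≫ η) (by simp only [Category.assoc, h]) := by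
  apply I.hom_ext <;> simp [InternalGroupoid.comp_mul]

lemma mul_assoc (γ η ζ : S ⟶ I.arr) (h : γ ≫ I.src = η ≫ I.tgt) (h' : η ≫ I.src = ζ ≫ I.tgt) :
    I.mul (I.mul γ η h) ζ ((I.mul_src γ η h).trans h') =
      I.mul γ (I.mul η ζ h') (h.trans (I.mul_tgt η ζ h').symm) := by
  refine I.hom_ext (by simp) (by simp) ?_
  simp only [mul_map]
  exact G.isGroupoid.mul_assoc _ _ _ (I.map_composable h) (I.map_composable h')

end Mul

@[simp] lemma one_src : I.one ≫ I.src = 𝟙 P := I.lift_src _ _ _ _ _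
@[simp] lemma one_tgt : I.one ≫ I.tgt = 𝟙 P := I.lift_tgt _ _ _ _ _
@[simp] lemma one_map : I.one ≫ I.map = q ≫ G.unit := I.lift_map _ _ _ _ _
@[simp] lemma inv_src : I.inv ≫ I.src = I.tgt := I.lift_src _ _ _ _ _
@[simp] lemma inv_tgt : I.inv ≫ I.tgt = I.src := I.lift_tgt _ _ _ _ _
@[simp] lemma inv_map : I.inv ≫ I.map = I.map ≫ G.inv := I.lift_map _ _ _ _ _

/-- The structure maps of the induced groupoid. -/
noncomputable def data : GroupoidData A where
  obj := P
  arr := I.arr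
  src := I.src
  tgt := I.tgt
  unit := I.one
  inv := I.inv
  pairs := pullback I.src I.tgt
  fst := pullback.fst _ _
  snd := pullback.snd _ _
  isPullback := IsPullback.of_hasPullback _ _
  m := I.mul (pullback.fst _ _) (pullback.snd _ _) pullback.condition

lemma data_mul {S : A} (γ η : S ⟶ I.arr) (h : γ ≫ I.src = η ≫ I.tgt) :
    I.data.mul γ η h = I.mul γ η h := by
  refine (I.comp_mul _ _ pullback.condition (I.data.isPullback.lift γ η h)).trans ?_
  congr 1
  · exact I.data.isPullback.lift_fst γ η h
  · exact I.data.isPullback.lift_snd γ η h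

lemma data_isGroupoid : I.data.IsGroupoid where
  unit_src := I.one_src
  unit_tgt := I.one_tgt
  inv_src := I.inv_src
  inv_tgt := I.inv_tgt
  m_src := I.mul_src _ _ pullback.condition
  m_tgt := I.mul_tgt _ _ pullback.condition
  unit_mul := by
    have h : (I.tgt ≫ I.one) ≫ I.src = 𝟙 I.arr ≫ I.tgt := by simp
    have e : I.mul (I.tgt ≫ I.one) (𝟙 _) h = 𝟙 _ := by
      refine I.hom_ext (by simp) (by simp) ?_
      simp only [mul_map, Category.assoc, one_map, Category.id_comp]
      simp only [← Category.assoc, InternalGroupoid.unit_mul]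
    exact (I.data_mul _ _ h).trans e
  mul_unit := by
    have h : 𝟙 I.arr ≫ I.src = (I.src ≫ I.one) ≫ I.tgt := by simp
    have e : I.mul (𝟙 _) (I.src ≫ I.one) h = 𝟙 _ := by
      refine I.hom_ext (by simp) (by simp) ?_
      simp only [mul_map, Category.assoc, one_map, Category.id_comp]
      simp only [← Category.assoc, InternalGroupoid.mul_unit]
    exact (I.data_mul _ _ h).trans e
  inv_mul := by
    have h : I.inv ≫ I.src = 𝟙 I.arr ≫ I.tgt := by simp
    have e : I.mul I.inv (𝟙 _) h = I.src ≫ I.one := by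
      refine I.hom_ext (by simp) (by simp) ?_
      simp only [mul_map, inv_map, Category.id_comp, InternalGroupoid.inv_mul, Category.assoc,
        one_map, reassoc_of% I.map_src]
    exact (I.data_mul _ _ h).trans e
  mul_inv := by
    have h : 𝟙 I.arr ≫ I.src = I.inv ≫ I.tgt := by simp
    have e : I.mul (𝟙 _) I.inv h = I.tgt ≫ I.one := by
      refine I.hom_ext (by simp) (by simp) ?_
      simp only [mul_map, inv_map, Category.id_comp, InternalGroupoid.mul_inv, Category.assoc,
        one_map, reassoc_of% I.map_tgt]
    exact (I.data_mul _ _ h).trans e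
  mul_assoc := by
    intro S f g k h h'
    have e (f f' g g' : S ⟶ I.arr) (hf : f = f') (hg : g = g') (h : f ≫ I.src = g ≫ I.tgt)
        (h' : f' ≫ I.src = g' ≫ I.tgt) : I.data.mul f g h = I.mul f' g' h' := by
      subst hf hg; exact I.data_mul f g h
    exact (e _ _ _ _ (I.data_mul f g h) rfl _ _).trans
      ((I.mul_assoc f g k h h').trans (e _ _ _ _ rfl (I.data_mul g k h') _ _).symm)

/-- The induced groupoid. -/
noncomputable def grpd : InternalGroupoid T where
  toGroupoidData := I.data
  isGroupoid := I.data_isGroupoid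
  tgt_admissible := I.tgt_admissible

/-- The projection of the induced groupoid to `G`. -/
noncomputable def hom : I.grpd ⟶ G :=
  Hom.ofMul (H := I.grpd) q I.map I.map_src I.map_tgt
    (I.mul_map _ _ pullback.condition)

lemma hom_fullyFaithful : FullyFaithful I.hom := I.univ

section Constructions

variable {P : A} [T.HasIsos] [T.IsStableUnderComposition] (G : InternalGroupoid T)

/-- Arrows can be pulled back along an admissible epimorphism onto the objects. -/
noncomputable def ofAdmissible {q : P ⟶ G.obj} (hq : AdmissibleEpi T q) : ArrowPullback G q :=
  haveI : HasPullback G.src q := G.src_admissible.1 q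
  have h₁ : IsPullback (pullback.fst G.src q) (pullback.snd G.src q) G.src q :=
    IsPullback.of_hasPullback _ _
  haveI : HasPullback q (pullback.fst G.src q ≫ G.tgt) := hq.1 _
  have h₂ : IsPullback (pullback.fst q (pullback.fst G.src q ≫ G.tgt))
    (pullback.snd q (pullback.fst G.src q ≫ G.tgt)) q (pullback.fst G.src q ≫ G.tgt) :=
    IsPullback.of_hasPullback _ _
  { arr := pullback q (pullback.fst G.src q ≫ G.tgt)
    src := pullback.snd _ _ ≫ pullback.snd _ _
    tgt := pullback.fst _ _
    map := pullback.snd _ _ ≫ pullback.fst _ _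
    map_src := by simp only [Category.assoc, h₁.w]
    map_tgt := by simp only [Category.assoc, h₂.w]
    univ := fun S x y γ hx hy => by
      refine ⟨h₂.lift y (h₁.lift γ x hx) (by rw [h₁.lift_fst_assoc, hy]), ⟨?_, ?_, ?_⟩, ?_⟩
      · rw [h₂.lift_snd_assoc, h₁.lift_snd]
      · rw [h₂.lift_fst]
      · rw [h₂.lift_snd_assoc, h₁.lift_fst]
      · rintro k ⟨e₁, e₂, e₃⟩
        refine h₂.hom_ext (by rw [h₂.lift_fst, e₂]) (h₁.hom_ext ?_ ?_)
        · rw [h₂.lift_snd, h₁.lift_fst, Category.assoc, e₃]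
        · rw [h₂.lift_snd, h₁.lift_snd, Category.assoc, e₁]
    tgt_admissible := ((hq.of_isPullback h₁.flip).comp G.tgt_admissible).of_isPullback h₂.flip }

/-- Arrows can be restricted to an invariant subobject of the objects. -/
noncomputable def ofInvariant (q : P ⟶ G.obj) [Mono q]
    (h : ∀ ⦃S : A⦄ (γ : S ⟶ G.arr) (x : S ⟶ P), x ≫ q = γ ≫ G.src →
      ∃ y : S ⟶ P, y ≫ q = γ ≫ G.tgt) : ArrowPullback G q :=
  haveI : HasPullback G.src q := G.src_admissible.1 q
  have h₁ : IsPullback (pullback.fst G.src q) (pullback.snd G.src q) G.src q :=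
    IsPullback.of_hasPullback _ _
  have hr := h (pullback.fst G.src q) (pullback.snd G.src q) h₁.w.symm
  { arr := pullback G.src q
    src := pullback.snd _ _
    tgt := hr.choose
    map := pullback.fst _ _
    map_src := h₁.w
    map_tgt := hr.choose_spec.symm
    univ := fun S x y γ hx hy => by
      refine ⟨h₁.lift γ x hx, ⟨h₁.lift_snd _ _ _, ?_, h₁.lift_fst _ _ _⟩, ?_⟩
      · rw [← cancel_mono q, Category.assoc, hr.choose_spec, h₁.lift_fst_assoc, hy]
      · rintro k ⟨e₁, -, e₃⟩
        exact h₁.hom_ext (by rw [h₁.lift_fst, e₃]) (by rw [h₁.lift_snd, e₁])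
    tgt_admissible := by
      refine G.tgt_admissible.of_isPullback (p := pullback.fst G.src q) (g := q)
        (isPullback_of_existsUnique hr.choose_spec.symm fun S γ y hy => ?_)
      -- By invariance under `γ⁻¹`, an arrow with range in `P` has its source in `P` as well.
      obtain ⟨x, hx⟩ := h (γ ≫ G.inv) y (by simp [hy])
      have hx' : γ ≫ G.src = x ≫ q := by simp [hx]
      refine ⟨h₁.lift γ x hx', ⟨h₁.lift_fst _ _ _, ?_⟩, fun k hk => h₁.hom_ext ?_ ?_⟩
      · rw [← cancel_mono q, Category.assoc, hr.choose_spec, h₁.lift_fst_assoc, hy]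
      · rw [h₁.lift_fst, hk.1]
      · rw [← cancel_mono q, h₁.lift_snd, Category.assoc, ← h₁.w, reassoc_of% hk.1, hx'] }

end Constructions

end ArrowPullback

section Lifting

variable {H K L G C E : InternalGroupoid T}

/-- A groupoid induced along an admissible epimorphism is essentially equivalent to the original
one. -/
lemma ArrowPullback.hom_essentialEquiv [T.HasIsos] [T.HasPullbacks] [T.IsStableUnderBaseChange]
    [T.IsStableUnderComposition] (hsub : IsSubcanonical T) (hdesc : EffectiveDescent T)
    {P : A} {q : P ⟶ G.obj} (I : ArrowPullback G q) (hq : AdmissibleEpi T q) :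
    EssentialEquiv I.hom := by
  refine .of_locallyEssSurj hsub hdesc I.hom_fullyFaithful fun S y => ?_
  have := hq.1 y
  have hp := IsPullback.of_hasPullback q y
  obtain ⟨-, R, hR, hl⟩ := hq.2 _ _ _ hp
  obtain ⟨ι, V, p, rfl⟩ := R.exists_eq_ofArrows
  refine ⟨ι, V, p, hR, fun i => ?_⟩
  obtain ⟨l, hl⟩ := hl (p i) ⟨i⟩
  have e : (l ≫ pullback.fst q y) ≫ q = p i ≫ y := by rw [Category.assoc, hp.w, reassoc_of% hl]
  refine ⟨l ≫ pullback.fst q y, (p i ≫ y) ≫ G.unit, ?_, by simp⟩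
  rw [comp_unit_src, ← e]
  rfl

/-- A strict arrow `ψ` lifts through a fully faithful `u`, up to natural isomorphism, as soon as
its map of objects does. -/
lemma FullyFaithful.exists_lift {u : L ⟶ G} (hu : FullyFaithful u) (ψ : H ⟶ G)
    (x : H.obj ⟶ L.obj) (σ : H.obj ⟶ G.arr) (hσ : σ ≫ G.src = x ≫ u.obj)
    (hσ' : σ ≫ G.tgt = ψ.obj) : ∃ ψ' : H ⟶ L, NatIso (ψ' ≫ u) ψ := by
  obtain ⟨c, hc₁, hc₂, hc⟩ := Comm.exists_top ψ.arr (H.src ≫ σ) (H.tgt ≫ σ)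
    (by simp [hσ', ψ.arr_src]) (by simp [hσ', ψ.arr_tgt])
  obtain ⟨a, ⟨ha₁, ha₂, ha₃⟩, -⟩ := hu (H.src ≫ x) (H.tgt ≫ x) c (by simp [hc₁, hσ])
    (by simp [hc₂, hσ])
  have hw : (H.fst ≫ a) ≫ L.src = (H.snd ≫ a) ≫ L.tgt := by
    simp only [Category.assoc, ha₁, ha₂, reassoc_of% H.isPullback.w]
  refine ⟨Hom.ofMul x a ha₁ ha₂ ?_, σ, hσ, hσ', ?_⟩
  · refine hu.hom_ext ?_ ?_ ?_
    · simp [ha₁, reassoc_of% H.isGroupoid.m_src]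
    · simp [ha₂, reassoc_of% H.isGroupoid.m_tgt]
    · rw [mul_arr, Category.assoc]
      simp only [Category.assoc, ha₃]
      have h₁ := hc.precomp H.fst
      have h₂ := hc.precomp H.snd
      have h₃ := hc.precomp H.m
      rw [← reassoc_of% H.isPullback.w] at h₂
      have h₄ := h₂.mul h₁ (by simp [hc₁, hc₂, reassoc_of% H.isPullback.w])
        (by simp [ψ.arr_src, ψ.arr_tgt, reassoc_of% H.isPullback.w])
      simp only [reassoc_of% H.isGroupoid.m_src, reassoc_of% H.isGroupoid.m_tgt, ψ.m_arr] at h₃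
      exact h₃.eq_top h₄
  · change G.Comm (a ≫ u.arr) _ _ _
    rwa [ha₃]

section

variable [T.HasIsos] [T.HasPullbacks] [T.IsStableUnderBaseChange] [T.IsStableUnderComposition]

/-- Essential equivalences can be pulled back along arbitrary strict arrows, up to natural
isomorphism. -/
lemma EssentialEquiv.exists_pullback (hsub : IsSubcanonical T) (hdesc : EffectiveDescent T)
    {u : E ⟶ C} (hu : EssentialEquiv u) (k : L ⟶ C) :
    ∃ (L' : InternalGroupoid T) (w : L' ⟶ L) (k' : L' ⟶ E),
      EssentialEquiv w ∧ NatIso (k' ≫ u) (w ≫ k) := by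
  obtain ⟨⟨P, p₁, p₂, hP, ha⟩, hff⟩ := hu
  have := ha.1 k.obj
  have hQ := IsPullback.of_hasPullback (p₁ ≫ C.tgt) k.obj
  have hq := ha.of_isPullback hQ
  let I := ArrowPullback.ofAdmissible L hq
  have hσ : (pullback.fst (p₁ ≫ C.tgt) k.obj ≫ p₁) ≫ C.src =
      (pullback.fst (p₁ ≫ C.tgt) k.obj ≫ p₂) ≫ u.obj := by simp only [Category.assoc, hP.w]
  have hσ' : (pullback.fst (p₁ ≫ C.tgt) k.obj ≫ p₁) ≫ C.tgt =
      pullback.snd (p₁ ≫ C.tgt) k.obj ≫ k.obj := by rw [Category.assoc, hQ.w]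
  obtain ⟨k', hk'⟩ := hff.exists_lift (I.hom ≫ k) (pullback.fst (p₁ ≫ C.tgt) k.obj ≫ p₂)
    (pullback.fst (p₁ ≫ C.tgt) k.obj ≫ p₁) hσ hσ'
  exact ⟨I.grpd, I.hom, k', I.hom_essentialEquiv hsub hdesc hq, hk'⟩

end

/-- Strict arrows out of point groupoids lift through essential equivalences, since points lift
along admissible epimorphisms. -/
lemma EssentialEquiv.exists_lift_point (hpoint : PointsLift T) {u : E ⟶ C} (hu : EssentialEquiv u)
    {P : InternalGroupoid T} (hP : IsPointGroupoid P) (j : P ⟶ C) :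
    ∃ j' : P ⟶ E, NatIso (j' ≫ u) j := by
  obtain ⟨⟨Q, p₁, p₂, hQ, ha⟩, hff⟩ := hu
  have := ha.1 j.obj
  have hR := IsPullback.of_hasPullback (p₁ ≫ C.tgt) j.obj
  obtain ⟨x, hx⟩ := hpoint _ hP (ha.of_isPullback hR)
  refine hff.exists_lift j (x ≫ pullback.fst _ _ ≫ p₂) (x ≫ pullback.fst _ _ ≫ p₁)
    (by simp only [Category.assoc, hQ.w]) ?_
  rw [Category.assoc, Category.assoc, hR.w, reassoc_of% hx]

end Lifting

/-! ### Homotopy pullbacks and composites of spans -/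

section Composites

variable {H J K G L P : InternalGroupoid T} [T.HasIsos] [T.IsStableUnderComposition]

lemma IsHomotopyPullback.exists_isNatTrans {φ : K ⟶ G} {ψ : J ⟶ G} {p : P ⟶ K} {q : P ⟶ J}
    (hP : IsHomotopyPullback φ ψ p q) : ∃ τ : P.obj ⟶ G.arr, IsNatTrans τ (p ≫ φ) (q ≫ ψ) ∧
    (∀ ⦃S : A⦄ (x : S ⟶ K.obj) (σ : S ⟶ G.arr) (y : S ⟶ J.obj),
      σ ≫ G.src = x ≫ φ.obj → σ ≫ G.tgt = y ≫ ψ.obj →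
      ∃! z : S ⟶ P.obj, z ≫ p.obj = x ∧ z ≫ τ = σ ∧ z ≫ q.obj = y) ∧
    (∀ ⦃S : A⦄ (κ : S ⟶ K.arr) (σ : S ⟶ G.arr) (ι : S ⟶ J.arr),
      σ ≫ G.src = (κ ≫ K.src) ≫ φ.obj → σ ≫ G.tgt = (ι ≫ J.src) ≫ ψ.obj →
      ∃! z : S ⟶ P.arr, z ≫ p.arr = κ ∧ z ≫ P.src ≫ τ = σ ∧ z ≫ q.arr = ι) := by
  obtain ⟨h, h₀, h₁, hobj, harr⟩ := hP
  have hnat := isNatTrans_path h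
  rw [h₀, h₁] at hnat
  exact ⟨h.obj, hnat, hobj, harr⟩

/-- A natural isomorphism `a ≫ φ ≅ b ≫ ψ` is a cone over the homotopy pullback. -/
lemma IsHomotopyPullback.exists_lift {φ : K ⟶ G} {ψ : J ⟶ G} {p : P ⟶ K} {q : P ⟶ J}
    (hP : IsHomotopyPullback φ ψ p q) {a : H ⟶ K} {b : H ⟶ J} (hab : NatIso (a ≫ φ) (b ≫ ψ)) :
    ∃ c : H ⟶ P, c ≫ p = a ∧ c ≫ q = b := by
  obtain ⟨τ, hnat, hobj, harr⟩ := hP.exists_isNatTrans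
  obtain ⟨t, ht⟩ := hab
  have hs : t ≫ G.src = a.obj ≫ φ.obj := ht.src
  have hr : t ≫ G.tgt = b.obj ≫ ψ.obj := ht.tgt
  obtain ⟨z, ⟨hz₁, hz₂, hz₃⟩, -⟩ := hobj a.obj t b.obj hs hr
  obtain ⟨w, ⟨hw₁, hw₂, hw₃⟩, -⟩ := harr a.arr (H.src ≫ t) b.arr
    (by rw [a.arr_src, Category.assoc, Category.assoc, hs])
    (by rw [b.arr_src, Category.assoc, Category.assoc, hr])
  have ext_obj {S : A} {k k' : S ⟶ P.obj} (e₁ : k ≫ p.obj = k' ≫ p.obj)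
      (e₂ : k ≫ τ = k' ≫ τ) (e₃ : k ≫ q.obj = k' ≫ q.obj) : k = k' := by
    refine (hobj (k' ≫ p.obj) (k' ≫ τ) (k' ≫ q.obj) ?_ ?_).unique ⟨e₁, e₂, e₃⟩ ⟨rfl, rfl, rfl⟩
    · simp [hnat.src]
    · simp [hnat.tgt]
  have ext_arr {S : A} {k k' : S ⟶ P.arr} (e₁ : k ≫ p.arr = k' ≫ p.arr)
      (e₂ : k ≫ P.src ≫ τ = k' ≫ P.src ≫ τ) (e₃ : k ≫ q.arr = k' ≫ q.arr) : k = k' := by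
    refine (harr (k' ≫ p.arr) (k' ≫ P.src ≫ τ) (k' ≫ q.arr) ?_ ?_).unique ⟨e₁, e₂, e₃⟩
      ⟨rfl, rfl, rfl⟩
    · simp [hnat.src, reassoc_of% p.arr_src]
    · simp [hnat.tgt, reassoc_of% q.arr_src]
  -- The source is determined by construction, the range by the naturality of `τ` and `t`.
  have hwsrc : w ≫ P.src = H.src ≫ z := ext_obj
    (by rw [Category.assoc, ← p.arr_src, reassoc_of% hw₁, a.arr_src, Category.assoc, hz₁])
    (by rw [Category.assoc, hw₂, Category.assoc, hz₂])
    (by rw [Category.assoc, ← q.arr_src, reassoc_of% hw₃, b.arr_src, Category.assoc, hz₃])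
  have hwtgt : w ≫ P.tgt = H.tgt ≫ z := by
    refine ext_obj
      (by rw [Category.assoc, ← p.arr_tgt, reassoc_of% hw₁, a.arr_tgt, Category.assoc, hz₁]) ?_
      (by rw [Category.assoc, ← q.arr_tgt, reassoc_of% hw₃, b.arr_tgt, Category.assoc, hz₃])
    have e := hnat.comm.precomp w
    simp only [comp_hom_arr, reassoc_of% hw₁, reassoc_of% hw₃] at e
    rw [hw₂] at e
    rw [Category.assoc, Category.assoc, hz₂]
    exact e.flip.eq_bot ht.comm.flip
  have hww : (H.fst ≫ w) ≫ P.src = (H.snd ≫ w) ≫ P.tgt := by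
    rw [Category.assoc, Category.assoc, hwsrc, hwtgt, reassoc_of% H.isPullback.w]
  refine ⟨Hom.ofMul z w hwsrc hwtgt (ext_arr ?_ ?_ ?_), Hom.ext hz₁ hw₁, Hom.ext hz₃ hw₃⟩
  · rw [mul_arr, Category.assoc, hw₁, a.m_arr]
    simp only [Category.assoc, hw₁]
  · rw [Category.assoc, hw₂, ← Category.assoc (P.mul _ _ _), InternalGroupoid.mul_src,
      Category.assoc, Category.assoc, hw₂, reassoc_of% H.isGroupoid.m_src]
  · rw [mul_arr, Category.assoc, hw₃, b.m_arr]
    simp only [Category.assoc, hw₃]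

lemma IsIteratedHomotopyPullback.exists_lift {φ : K ⟶ G} {n : ℕ} {ψ : J ⟶ G} {p : P ⟶ K}
    {q : P ⟶ J} (hP : IsIteratedHomotopyPullback φ n ψ p q) {a : H ⟶ K} {b : H ⟶ J}
    (hab : NatIso (a ≫ φ) (b ≫ ψ)) : ∃ c : H ⟶ P, c ≫ p = a ∧ c ≫ q = b := by
  induction n generalizing J P with
  | zero => exact IsHomotopyPullback.exists_lift hP hab
  | succ n ih =>
    obtain ⟨Q, p', q', f, hQ, hP, rfl⟩ := hP
    obtain ⟨d, rfl, hd⟩ := ih hQ (b := a ≫ φ) (by simpa using NatIso.refl _)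
    obtain ⟨c, hc, hc'⟩ := hP.exists_lift (a := d) (b := b) (by rwa [hd])
    exact ⟨c, by rw [← hc, Category.assoc], hc'⟩

variable [T.HasPullbacks] [T.IsStableUnderBaseChange]

/-- If the composite of the spans `F` and `F'` is Morita homotopic to the identity, then for
matching arrows `a`, `b` into the apexes the two induced arrows to `K` are naturally isomorphic,
up to restriction along an essential equivalence. -/
lemma IsComposite.exists_natIso (hsub : IsSubcanonical T) (hdesc : EffectiveDescent T)
    {F : Span K G} {F' : Span G K} {C : Span K K} (hC : IsComposite F F' C)
    (hid : MoritaHomotopic C (Span.ofHom (𝟙 K))) {a : H ⟶ F.apex} {b : H ⟶ F'.apex}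
    (hab : NatIso (a ≫ F.right) (b ≫ F'.left)) :
    ∃ (H' : InternalGroupoid T) (w : H' ⟶ H), EssentialEquiv w ∧
      NatIso (w ≫ a ≫ F.left) (w ≫ b ≫ F'.right) := by
  obtain ⟨n, p, q, hpq, hl, hr⟩ := hC
  obtain ⟨E, u, v, hu, -, h₁, h₂⟩ := hid
  rw [essentialHomotopyEquiv_iff hsub hdesc] at hu
  rw [stronglyHomotopic_iff] at h₁ h₂
  obtain ⟨c, rfl, rfl⟩ := hpq.exists_lift hab
  obtain ⟨H', w, k, hw, hk⟩ := hu.exists_pullback hsub hdesc c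
  refine ⟨H', w, hw, ?_⟩
  have e₁ := hk.whisker_right C.left
  have e₂ := hk.whisker_right C.right
  have e₃ := (h₁.trans h₂.symm).whisker_left k
  simp only [hl, hr, Category.assoc] at e₁ e₂ e₃
  simpa only [Category.assoc] using e₁.symm.trans (e₃.trans e₂)

end Composites

/-! ### Transport of invariant subobjects -/

section Transport

variable {M J N : InternalGroupoid T}

/-- For `M ⟵ J ⟶ N` with legs `η`, `φ` and a subobject `i : U ⟶ N₀`, the objects `m` of `M` such
that `φ x` lies in `U` for all `x` over all stages with an arrow `η x ⟶ m`. -/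
def Transported (η : J ⟶ M) (φ : J ⟶ N) {U : A} (i : U ⟶ N.obj) ⦃S : A⦄ (m : S ⟶ M.obj) : Prop :=
  ∀ ⦃S' : A⦄ (k : S' ⟶ S) (x : S' ⟶ J.obj) (μ : S' ⟶ M.arr), μ ≫ M.src = x ≫ η.obj →
    μ ≫ M.tgt = k ≫ m → ∃ y : S' ⟶ U, y ≫ i = x ≫ φ.obj

variable {η : J ⟶ M} {φ : J ⟶ N} {U : A} {i : U ⟶ N.obj}

lemma Transported.precomp {S S' : A} (k : S' ⟶ S) {m : S ⟶ M.obj} (h : Transported η φ i m) :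
    Transported η φ i (k ≫ m) := fun _ l x μ h₁ h₂ =>
  h (l ≫ k) x μ h₁ (by rw [h₂, Category.assoc])

/-- For an object with a preimage `x` under `η`, membership in the transported subobject is
decided by that preimage, as `η` is fully faithful and `U` is invariant. -/
lemma transported_iff (hη : FullyFaithful η)
    (hU : ∀ ⦃S : A⦄ (γ : S ⟶ N.arr) (x : S ⟶ U), x ≫ i = γ ≫ N.src →
      ∃ y : S ⟶ U, y ≫ i = γ ≫ N.tgt) {S : A} {m : S ⟶ M.obj} (x : S ⟶ J.obj) (μ : S ⟶ M.arr)
    (h₁ : μ ≫ M.src = x ≫ η.obj) (h₂ : μ ≫ M.tgt = m) :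
    Transported η φ i m ↔ ∃ y : S ⟶ U, y ≫ i = x ≫ φ.obj := by
  refine ⟨fun h => h (𝟙 S) x μ h₁ (by rw [h₂, Category.id_comp]), ?_⟩
  rintro ⟨y, hy⟩ S' k x' μ' h₃ h₄
  obtain ⟨f, hf₁, hf₂, -⟩ := exists_mul_eq (k ≫ μ) μ' (by rw [Category.assoc, h₂, h₄])
  obtain ⟨ζ, ⟨hζ₁, hζ₂, -⟩, -⟩ := hη (k ≫ x) x' f
    (by rw [hf₁, Category.assoc, h₁, Category.assoc]) (by rw [hf₂, h₃])
  obtain ⟨y', hy'⟩ := hU (ζ ≫ φ.arr) (k ≫ y) (by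
    rw [Category.assoc, hy, Category.assoc, φ.arr_src, reassoc_of% hζ₁])
  exact ⟨y', by rw [hy', Category.assoc, φ.arr_tgt, reassoc_of% hζ₂]⟩

lemma Transported.invariant {S : A} (γ : S ⟶ M.arr) (h : Transported η φ i (γ ≫ M.src)) :
    Transported η φ i (γ ≫ M.tgt) := by
  intro S' k x μ h₁ h₂
  obtain ⟨f, hf₁, hf₂, -⟩ := exists_mul_eq μ (k ≫ γ) (by rw [h₂, Category.assoc])
  exact h k x f (by rw [hf₁, h₁]) (by rw [hf₂, Category.assoc])

lemma Transported.of_cover [T.HasPullbacks] [T.IsStableUnderBaseChange] (hsub : IsSubcanonical T)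
    [Mono i] {S : A} {m : S ⟶ M.obj} {ι : Type*} {V : ι → A} {p : ∀ j, V j ⟶ S}
    (hV : Presieve.ofArrows V p ∈ T S) (h : ∀ j, Transported η φ i (p j ≫ m)) :
    Transported η φ i m := by
  intro S' k x μ h₁ h₂
  obtain ⟨W, a, b, hab, hW⟩ := exists_cover_pullback hV k
  refine hsub.exists_factor i hW fun j => ?_
  obtain ⟨y, hy⟩ := h j (b j) (a j ≫ x) (a j ≫ μ) (by simp [h₁])
    (by rw [Category.assoc, h₂, reassoc_of% (hab j).w])
  exact ⟨y, by rw [hy, Category.assoc]⟩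

/-- Effective descent glues the preimages of `U` over the members of a cover of `M₀` that lifts
to `J₀`. -/
lemma exists_transported [T.HasPullbacks] [T.IsStableUnderBaseChange] (hsub : IsSubcanonical T)
    (hdesc : EffectiveDescent T) [Mono i] (hη : FullyFaithful η) (hes : LocallyEssSurj η)
    (hU : ∀ ⦃S : A⦄ (γ : S ⟶ N.arr) (x : S ⟶ U), x ≫ i = γ ≫ N.src →
      ∃ y : S ⟶ U, y ≫ i = γ ≫ N.tgt)
    (hpb : ∀ ⦃S : A⦄ (g : S ⟶ N.obj), HasPullback i g) :
    ∃ (V : A) (b : V ⟶ M.obj), Mono b ∧ Transported η φ i b ∧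
      ∀ ⦃S : A⦄ (m : S ⟶ M.obj), Transported η φ i m → ∃ k : S ⟶ V, k ≫ b = m := by
  obtain ⟨ι, W, w, hW, hl⟩ := hes (𝟙 M.obj)
  choose x μ h₁ h₂ using hl
  simp only [Category.comp_id] at h₂
  obtain ⟨V, b, c, hbc, hV⟩ := hdesc.representedOver hsub (X := M.obj) (Z := M.obj)
    (fun S s z => s = z ∧ Transported η φ i s)
    (by rintro S S' k s _ ⟨rfl, h⟩; exact ⟨rfl, h.precomp k⟩)
    (fun S s z ι V p hp h => ⟨hsub.hom_ext hp fun j => (h j).1, .of_cover hsub hp fun j => (h j).2⟩)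
    hW (fun j => by
      have := hpb (x j ≫ φ.obj)
      have hB := IsPullback.of_hasPullback i (x j ≫ φ.obj)
      refine ⟨_, pullback.snd i (x j ≫ φ.obj), pullback.snd i (x j ≫ φ.obj) ≫ w j, ⟨rfl, ?_⟩, ?_⟩
      · refine (transported_iff hη hU (pullback.snd i (x j ≫ φ.obj) ≫ x j)
          (pullback.snd i (x j ≫ φ.obj) ≫ μ j) (by simp [h₁]) (by simp [h₂])).2
          ⟨pullback.fst _ _, by rw [hB.w, Category.assoc]⟩
      · rintro S s _ ⟨rfl, hs⟩
        obtain ⟨y, hy⟩ := (transported_iff hη hU (s ≫ x j) (s ≫ μ j) (by simp [h₁])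
          (by simp [h₂])).1 hs
        rw [Category.assoc] at hy
        refine ⟨hB.lift y s hy, ⟨hB.lift_snd _ _ _, by rw [hB.lift_snd_assoc]⟩, fun k hk => ?_⟩
        refine hB.hom_ext ?_ (by rw [hB.lift_snd, hk.1])
        rw [hB.lift_fst, ← cancel_mono i, Category.assoc, hB.w, reassoc_of% hk.1, hy])
  simp only [Category.comp_id] at hbc hV
  obtain ⟨rfl, hb⟩ := hbc
  refine ⟨V, b, ⟨fun k k' hk => ?_⟩, hb, fun S m hm => ?_⟩
  · exact (hV (k' ≫ b) (k' ≫ b) ⟨rfl, hb.precomp k'⟩).unique ⟨hk, hk⟩ ⟨rfl, rfl⟩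
  · obtain ⟨k, hk, -⟩ := hV m m ⟨rfl, hm⟩
    exact ⟨k, hk.1⟩

/-- Transport takes covers by invariant subobjects to covers, since being a cover is local. -/
lemma transported_cover [T.HasPullbacks] [T.IsStableUnderBaseChange] (hloc : CoversAreLocal T)
    (hη : FullyFaithful η) (hes : LocallyEssSurj η) {κ : Type (max u v)} {U : κ → A}
    {i : ∀ k, U k ⟶ N.obj} [∀ k, Mono (i k)]
    (hU : ∀ (k : κ) ⦃S : A⦄ (γ : S ⟶ N.arr) (x : S ⟶ U k), x ≫ i k = γ ≫ N.src →
      ∃ y : S ⟶ U k, y ≫ i k = γ ≫ N.tgt)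
    (hcov : Presieve.ofArrows U i ∈ T N.obj) {V : κ → A} {b : ∀ k, V k ⟶ M.obj}
    [∀ k, Mono (b k)] (hb : ∀ k, Transported η φ (i k) (b k))
    (hV : ∀ (k : κ) ⦃S : A⦄ (m : S ⟶ M.obj), Transported η φ (i k) m → ∃ l : S ⟶ V k, l ≫ b k = m) :
    Presieve.ofArrows V b ∈ T M.obj := by
  obtain ⟨ι, W, w, hW, hl⟩ := hes (𝟙 M.obj)
  choose x μ h₁ h₂ using hl
  simp only [Category.comp_id] at h₂
  choose P p q hpq hP using fun j => exists_cover_pullback hcov (x j ≫ φ.obj)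
  have ht (j : ι) (k : κ) {S : A} (s : S ⟶ W j) :
      Transported η φ (i k) (s ≫ w j) ↔ ∃ y : S ⟶ U k, y ≫ i k = s ≫ x j ≫ φ.obj := by
    simpa using transported_iff (φ := φ) hη (hU k) (s ≫ x j) (s ≫ μ j) (by simp [h₁])
      (by simp [h₂] : _ = s ≫ w j)
  have hr (j : ι) (k : κ) : ∃ r : P j k ⟶ V k, r ≫ b k = p j k ≫ w j :=
    hV k _ ((ht j k (p j k)).2 ⟨q j k, (hpq j k).w.symm⟩)
  choose r hr using hr
  refine hloc W w V b P p r hW (fun j k => isPullback_of_existsUnique (hr j k).symm fun S s v hs => ?_) hP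
  obtain ⟨y, hy⟩ := (ht j k s).1 (by rw [hs]; exact (hb k).precomp v)
  have e : (hpq j k).lift s y hy.symm ≫ p j k = s := (hpq j k).lift_fst _ _ _
  refine ⟨(hpq j k).lift s y hy.symm, ⟨e, ?_⟩, fun l hl => (hpq j k).hom_ext ?_ ?_⟩
  · rw [← cancel_mono (b k), Category.assoc, hr, reassoc_of% e, hs]
  · rw [hl.1, e]
  · rw [← cancel_mono (i k), Category.assoc, Category.assoc, ← (hpq j k).w, reassoc_of% e,
      reassoc_of% hl.1]

end Transport

/-! ### Invariance of the geometric complexity -/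

section Complexity

variable {M N : InternalGroupoid T}
variable [T.HasIsos] [T.HasPullbacks] [T.IsStableUnderBaseChange] [T.IsStableUnderComposition]

/-- The inclusion of a weak point subgroupoid factors through a point groupoid up to natural
isomorphism, after restriction along an essential equivalence. -/
lemma InvariantSubgroupoid.isWeakPoint_iff (hsub : IsSubcanonical T) (hdesc : EffectiveDescent T)
    (U : InvariantSubgroupoid N) :
    U.IsWeakPoint ↔ ∃ (L P : InternalGroupoid T) (u : L ⟶ U.grpd) (c : L ⟶ P) (j : P ⟶ N),
      EssentialEquiv u ∧ IsPointGroupoid P ∧ NatIso (u ≫ U.incl) (c ≫ j) := by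
  constructor
  · rintro ⟨F, ⟨hF, P, c, j, hP, hc⟩, L, u, v, hu, -, h₁, h₂⟩
    rw [essentialHomotopyEquiv_iff hsub hdesc] at hu
    rw [stronglyHomotopic_iff] at h₂
    refine ⟨L, P, u, v ≫ c, j, hu, hP, ?_⟩
    rw [hc] at h₂
    rw [Category.assoc]
    exact h₂
  · rintro ⟨L, P, u, c, j, hu, hP, h⟩
    refine ⟨⟨L, u, c ≫ j⟩, ⟨hu, P, c, j, hP, rfl⟩, L, u, 𝟙 L,
      (essentialHomotopyEquiv_iff hsub hdesc).2 hu,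
      (essentialHomotopyEquiv_iff hsub hdesc).2 (.id hsub hdesc),
      stronglyHomotopic_iff.2 ?_, stronglyHomotopic_iff.2 ?_⟩
    · change NatIso (u ≫ 𝟙 _) (𝟙 L ≫ u)
      rw [Category.comp_id, Category.id_comp]
      exact NatIso.refl _
    · change NatIso (u ≫ U.incl) (𝟙 L ≫ c ≫ j)
      rwa [Category.id_comp]

/-- A transported weak point subgroupoid is a weak point subgroupoid. Its inclusion is compared,
through the apex of the span `F`, with the point of `N`; this point lifts along the left leg of
the inverse span `F'`, and since `F' ∘ F` is Morita homotopic to the identity, its image in `M`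
is the required point. -/
lemma InvariantSubgroupoid.IsWeakPoint.transport (hsub : IsSubcanonical T)
    (hdesc : EffectiveDescent T) (hpoint : PointsLift T) {F : Span M N} {F' : Span N M}
    {C : Span M M} (hF : EssentialEquiv F.left) (hF' : EssentialEquiv F'.left)
    (hC : IsComposite F F' C) (hid : MoritaHomotopic C (Span.ofHom (𝟙 M)))
    {U : InvariantSubgroupoid N} (hU : U.IsWeakPoint) (V : InvariantSubgroupoid M)
    (hV : Transported F.left F.right U.incl.obj V.incl.obj) : V.IsWeakPoint := by
  rw [isWeakPoint_iff hsub hdesc] at hU ⊢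
  obtain ⟨L, P, u, c, j, hu, hP, huj⟩ := hU
  obtain ⟨L₁, w₁, k₁, hw₁, μ, hμ⟩ := hF.exists_pullback hsub hdesc V.incl
  -- On `L₁`, the right leg of `F` takes its values in `U`, so it lifts to the full subgroupoid.
  obtain ⟨y, hy⟩ := hV w₁.obj k₁.obj μ hμ.src hμ.tgt
  obtain ⟨l, hl⟩ := U.fullyFaithful.exists_lift (k₁ ≫ F.right) y (y ≫ U.incl.obj ≫ N.unit)
    (by simp) (by simp [hy])
  obtain ⟨L₂, w₂, k₂, hw₂, h₂⟩ := hu.exists_pullback hsub hdesc l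
  obtain ⟨j', hj'⟩ := hF'.exists_lift_point hpoint hP j
  have hab : NatIso ((w₂ ≫ k₁) ≫ F.right) ((k₂ ≫ c ≫ j') ≫ F'.left) := by
    have e₁ := hl.whisker_left w₂
    have e₂ := h₂.whisker_right U.incl
    have e₃ := huj.whisker_left k₂
    have e₄ := hj'.whisker_left (k₂ ≫ c)
    simp only [Category.assoc] at e₁ e₂ e₃ e₄ ⊢
    exact e₁.symm.trans (e₂.symm.trans (e₃.trans e₄.symm))
  obtain ⟨L₃, w₃, hw₃, h₃⟩ := hC.exists_natIso hsub hdesc hid hab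
  refine ⟨L₃, P, w₃ ≫ w₂ ≫ w₁, w₃ ≫ k₂ ≫ c, j' ≫ F'.right,
    hw₃.comp hsub hdesc (hw₂.comp hsub hdesc hw₁), hP, ?_⟩
  have e := NatIso.whisker_left (w₃ ≫ w₂) ⟨μ, hμ⟩
  simp only [Category.assoc] at e h₃ ⊢
  exact e.symm.trans h₃

lemma cgeo_le (hsub : IsSubcanonical T) (hloc : CoversAreLocal T) (hdesc : EffectiveDescent T)
    (hpoint : PointsLift T) {F : Span M N} {F' : Span N M} {C : Span M M} (hF : F.IsFraction)
    (hF' : F'.IsFraction) (hC : IsComposite F F' C)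
    (hid : MoritaHomotopic C (Span.ofHom (𝟙 M))) : cgeo M ≤ cgeo N := by
  replace hF : EssentialEquiv F.left := (essentialHomotopyEquiv_iff hsub hdesc).1 hF
  replace hF' : EssentialEquiv F'.left := (essentialHomotopyEquiv_iff hsub hdesc).1 hF'
  refine le_iInf₂ fun n hn => ?_
  obtain ⟨U, hU, hcov⟩ := hn
  refine iInf₂_le n ?_
  have (k : Fin n) : Mono (U k).incl.obj := (U k).mono
  have hpb (k : Fin n) ⦃S : A⦄ (g : S ⟶ N.obj) : HasPullback (U k).incl.obj g :=
    (T.hasPullbacks_of_mem g hcov).hasPullback (Presieve.ofArrows.mk k)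
  choose V b hmono hb hV using fun k => exists_transported (η := F.left) (φ := F.right) hsub hdesc
    hF.2 hF.locallyEssSurj (U k).invariant (hpb k)
  have hinv (k : Fin n) ⦃S : A⦄ (γ : S ⟶ M.arr) (x : S ⟶ V k) (hx : x ≫ b k = γ ≫ M.src) :
      ∃ y : S ⟶ V k, y ≫ b k = γ ≫ M.tgt :=
    hV k _ (.invariant γ (hx ▸ (hb k).precomp x))
  let I (k : Fin n) := ArrowPullback.ofInvariant M (b k) (hinv k)
  let V' (k : Fin n) : InvariantSubgroupoid M :=
    { grpd := (I k).grpd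
      incl := (I k).hom
      mono := hmono k
      fullyFaithful := (I k).hom_fullyFaithful
      invariant := hinv k }
  refine ⟨V', fun k => (hU k).transport hsub hdesc hpoint hF hF' hC hid (V' k) (hb k), ?_⟩
  -- Locality of covers is stated for families indexed by types in `Type (max u v)`.
  have hlift {X : A} (Y : Fin n → A) (f : ∀ k, Y k ⟶ X) :
      Presieve.ofArrows (fun k : ULift.{max u v} (Fin n) => Y k.down) (fun k => f k.down) =
        Presieve.ofArrows Y f :=
    le_antisymm (by rintro _ _ ⟨k⟩; exact ⟨k.down⟩) (by rintro _ _ ⟨k⟩; exact ⟨ULift.up k⟩)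
  have := transported_cover (κ := ULift.{max u v} (Fin n)) (η := F.left) (φ := F.right) hloc hF.2
    hF.locallyEssSurj (i := fun k => (U k.down).incl.obj) (fun k => (U k.down).invariant)
    (by rwa [hlift (fun k => (U k).grpd.obj) (fun k => (U k).incl.obj)]) (V := fun k => V k.down)
    (b := fun k => b k.down) (fun k => hb k.down) (fun k => hV k.down)
  rwa [hlift V b] at this

end Complexity

end InternalGroupoid

end AbsoluteGeometry

theorem mainTheorem3 {A : Type u} [Category.{v} A] (T : Precoverage A)
    [T.HasIsos] [T.HasPullbacks] [T.IsStableUnderBaseChange] [T.IsStableUnderComposition]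
    (hsub : AbsoluteGeometry.IsSubcanonical T)
    (hloc : AbsoluteGeometry.CoversAreLocal T)
    (hdesc : AbsoluteGeometry.EffectiveDescent T)
    (hpoint : AbsoluteGeometry.PointsLift T)
    (M N : AbsoluteGeometry.InternalGroupoid T)
    (h : AbsoluteGeometry.InternalGroupoid.WEquivalent M N) :
    AbsoluteGeometry.InternalGroupoid.cgeo M = AbsoluteGeometry.InternalGroupoid.cgeo N := by
  obtain ⟨F, F', C, D, hF, hF', hC, hD, hCid, hDid⟩ := h
  exact le_antisymm
    (AbsoluteGeometry.InternalGroupoid.cgeo_le hsub hloc hdesc hpoint hF hF' hC hCid)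
    (AbsoluteGeometry.InternalGroupoid.cgeo_le hsub hloc hdesc hpoint hF' hF hD hDid)
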